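/- Let $n\ge 1$, let $\omega$ be a primitive $8$th root of unity, and put $X=\begin{bmatrix}0&1\\1&0\end{bmatrix}$, $Z=\begin{bmatrix}1&0\\0&-1\end{bmatrix}$, $H=\frac1{\sqrt2}\begin{bmatrix}1&1\\1&-1\end{bmatrix}$, $S=\begin{bmatrix}1&0\\0&\omega^2\end{bmatrix}$, $CZ=\mathrm{diag}(1,1,1,-1)$. For a $2\times 2$ matrix $U$ let $U_i$ denote $U$ acting on the $i$-th factor of $(\mathbb C^2)^{\otimes n}$, and let $CZ_{i\to i+1}$ denote $CZ$ acting on the factors $i,i+1$. Let $\mathrm{Pauli}_n=\langle X_1,\dots,X_n,Z_1,\dots,Z_n,\omega^2 I\rangle$, let $\mathrm{Cliff}_n$ be the normalizer of $\mathrm{Pauli}_n$ in the unitary group $U(2^n)$, and let $\mathcal C_n$ be the projective Clifford group, i.e. $\mathrm{Cliff}_n$ modulo all its scalar matrices (global phases), where products in $\mathcal C_n$ are written from left to right (opposite to matrix multiplication). Let $h_i,s_i,\Lambda_i\in\mathcal C_n$ be the classes of $H_i$, $S_i$, $CZ_{i\to i+1}$. For $n\ge2$ put $M=h_2\Lambda_1s_2^2h_2h_1s_1^2h_2\Lambda_1h_2$,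 and define the subgroups $$\mathcal{IN}_n=\begin{cases}\langle h_1,\;s_1^3h_1s_1h_1s_1\rangle,&n=1,\\ \langle h_1,h_2,s_2,h_1s_1^2h_1,M\rangle,&n=2,\\ \langle h_1,\dots,h_n,s_2,\dots,s_n,M,\Lambda_2,\dots,\Lambda_{n-1}\rangle,&n\ge3,\end{cases}$$ $$F_n=\begin{cases}\langle s_1^3h_1s_1h_1s_1\rangle,&n=1,\\ \langle h_2,s_2,s_1^3h_1s_1h_1s_1,M\rangle,&n=2,\\ \langle h_2,\dots,h_n,s_2,\dots,s_n,M,\Lambda_2,\dots,\Lambda_{n-1}\rangle,&n\ge3.\end{cases}$$ Theorem. The centralizer of $s_1$ in $\mathcal C_n$ is $$\mathrm{Cent}_{\mathcal C_n}(s_1)=\begin{cases}\langle s_1\rangle,&n=1,\\ \langle h_2,\dots,h_n,\;s_1,\dots,s_n,\;\Lambda_1,\dots,\Lambda_{n-1}\rangle,&n\ge2,\end{cases}$$ and for $n\ge 2$ the generator $s_1$ can be omitted. It is conjugate to $F_n$ in $\mathcal C_n$; in particular $\mathrm{Cent}_{\mathcal C_n}(s_1)=h_1s_1F_ns_1^3h_1$.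 Moreover $\mathcal{IN}_n$ is finite, $F_n$ is a normal subgroup of $\mathcal{IN}_n$ of index $2$, and hence $|\mathrm{Cent}_{\mathcal C_n}(s_1)|=|\mathcal{IN}_n|/2$. -/

import Mathlib

namespace QubitClifford

noncomputable section

/-- Labels of the computational basis of `n` qubits. The qubits are labelled by `Fin n`,
so qubit `1` of the usual numbering is `0 : Fin n`. -/
abbrev Basis (n : ℕ) : Type := Fin n → Fin 2

/-- The `2 ^ n × 2 ^ n` unitary matrices. -/
abbrev U (n : ℕ) := Matrix.unitaryGroup (Basis n) ℂ

/-- The primitive eighth roots of unity. -/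
abbrev EighthRoot : Type := {z : ℂ // IsPrimitiveRoot z 8}

/-! ### One-qubit matrices -/

/-- The Pauli matrix `X`. -/
def matX : Matrix (Fin 2) (Fin 2) ℂ := !![0, 1; 1, 0]

/-- The Pauli matrix `Z`. -/
def matZ : Matrix (Fin 2) (Fin 2) ℂ := !![1, 0; 0, -1]

/-- The Hadamard matrix. -/
def matH : Matrix (Fin 2) (Fin 2) ℂ := (1 / (Real.sqrt 2 : ℂ)) • !![1, 1; 1, -1]

/-- The phase matrix `diag(1, ω²)`. -/
def matS (ω : EighthRoot) : Matrix (Fin 2) (Fin 2) ℂ := !![1, 0; 0, (ω : ℂ) ^ 2]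

/-! ### Gates on `n` qubits -/

/-- The tensor product `f 0 ⊗ f 1 ⊗ ⋯ ⊗ f (n - 1)` of `2 × 2` matrices. -/
def tensorMat {n : ℕ} (f : Fin n → Matrix (Fin 2) (Fin 2) ℂ) : Matrix (Basis n) (Basis n) ℂ :=
  Matrix.of fun x y => ∏ k, f k (x k) (y k)

/-- The matrix `I ⊗ ⋯ ⊗ I ⊗ A ⊗ I ⊗ ⋯ ⊗ I` with `A` in position `i`. -/
def onQubit {n : ℕ} (i : Fin n) (A : Matrix (Fin 2) (Fin 2) ℂ) : Matrix (Basis n) (Basis n) ℂ :=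
  tensorMat (Function.update (fun _ => 1) i A)

/-- The controlled `Z` matrix on the qubits `i` and `j`: it multiplies a basis vector by `-1` if
both qubits are in state `1`, and fixes it otherwise. -/
def matCZ {n : ℕ} (i j : Fin n) : Matrix (Basis n) (Basis n) ℂ :=
  Matrix.diagonal fun x => if x i = 1 ∧ x j = 1 then -1 else 1

theorem tensorMat_mul {n : ℕ} (f g : Fin n → Matrix (Fin 2) (Fin 2) ℂ) :
    tensorMat f * tensorMat g = tensorMat fun k => f k * g k := by
  ext x y
  simp only [tensorMat, Matrix.mul_apply, Matrix.of_apply, ← Finset.prod_mul_distrib]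
  rw [Finset.prod_univ_sum]
  simp

theorem tensorMat_one {n : ℕ} :
    tensorMat (fun _ : Fin n => (1 : Matrix (Fin 2) (Fin 2) ℂ)) = 1 := by
  ext x y
  simp only [tensorMat, Matrix.of_apply, Matrix.one_apply]
  by_cases h : x = y
  · simp [h]
  · obtain ⟨k, hk⟩ := Function.ne_iff.mp h
    rw [if_neg h]
    exact Finset.prod_eq_zero (Finset.mem_univ k) (if_neg hk)

theorem tensorMat_star {n : ℕ} (f : Fin n → Matrix (Fin 2) (Fin 2) ℂ) :
    star (tensorMat f) = tensorMat fun k => star (f k) := by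
  ext x y
  simp [tensorMat, Matrix.star_apply]

theorem onQubit_one {n : ℕ} (i : Fin n) : onQubit i 1 = 1 := by
  rw [← tensorMat_one (n := n), onQubit]
  congr 1
  funext k
  by_cases h : k = i
  · subst h; simp
  · simp [h]

theorem onQubit_mul {n : ℕ} (i : Fin n) (A B : Matrix (Fin 2) (Fin 2) ℂ) :
    onQubit i A * onQubit i B = onQubit i (A * B) := by
  rw [onQubit, onQubit, onQubit, tensorMat_mul]
  congr 1
  funext k
  by_cases h : k = i
  · subst h; simp
  · simp [h]

theorem onQubit_comm {n : ℕ} {i j : Fin n} (hij : i ≠ j) (A B : Matrix (Fin 2) (Fin 2) ℂ) :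
    onQubit i A * onQubit j B = onQubit j B * onQubit i A := by
  rw [onQubit, onQubit, tensorMat_mul, tensorMat_mul]
  congr 1
  funext k
  by_cases h : k = i
  · subst h; simp [hij]
  · simp [h]

theorem onQubit_star {n : ℕ} (i : Fin n) (A : Matrix (Fin 2) (Fin 2) ℂ) :
    star (onQubit i A) = onQubit i (star A) := by
  rw [onQubit, onQubit, tensorMat_star]
  congr 1
  funext k
  by_cases h : k = i
  · subst h; simp
  · simp [h]

theorem onQubit_apply {n : ℕ} (i : Fin n) (A : Matrix (Fin 2) (Fin 2) ℂ) (x y : Basis n) :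
    onQubit i A x y = if ∀ k, k ≠ i → x k = y k then A (x i) (y i) else 0 := by
  simp only [onQubit, tensorMat, Matrix.of_apply]
  split_ifs with h
  · rw [Finset.prod_eq_single i]
    · simp
    · intro k _ hk
      simp [hk, h k hk]
    · simp
  · push Not at h
    obtain ⟨k, hk, hxy⟩ := h
    refine Finset.prod_eq_zero (Finset.mem_univ k) ?_
    simp [hk, hxy]

theorem onQubit_smul {n : ℕ} (i : Fin n) (c : ℂ) (A : Matrix (Fin 2) (Fin 2) ℂ) :
    onQubit i (c • A) = c • onQubit i A := by
  ext x y
  simp only [Matrix.smul_apply, onQubit_apply]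
  split_ifs <;> simp

theorem onQubit_mem {n : ℕ} (i : Fin n) {A : Matrix (Fin 2) (Fin 2) ℂ}
    (hA : A ∈ Matrix.unitaryGroup (Fin 2) ℂ) : onQubit i A ∈ Matrix.unitaryGroup (Basis n) ℂ := by
  rw [Matrix.mem_unitaryGroup_iff] at hA ⊢
  rw [onQubit_star, onQubit_mul, hA, onQubit_one]

theorem EighthRoot.pow_four (ω : EighthRoot) : (ω : ℂ) ^ 4 = -1 := by
  have h8 : (ω : ℂ) ^ 8 = 1 := ω.2.pow_eq_one
  have h4 : (ω : ℂ) ^ 4 ≠ 1 := ω.2.pow_ne_one_of_pos_of_lt (by norm_num) (by norm_num)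
  have h : ((ω : ℂ) ^ 4 - 1) * ((ω : ℂ) ^ 4 + 1) = 0 := by linear_combination h8
  rcases mul_eq_zero.mp h with h | h
  · exact absurd (sub_eq_zero.mp h) h4
  · exact eq_neg_of_add_eq_zero_left h

theorem EighthRoot.mul_star (ω : EighthRoot) :
    (ω : ℂ) ^ 2 * (starRingEnd ℂ) ((ω : ℂ) ^ 2) = 1 := by
  have h : ‖(ω : ℂ)‖ = 1 := ω.2.norm'_eq_one (by norm_num)
  rw [Complex.mul_conj, Complex.normSq_eq_norm_sq, norm_pow, h]
  norm_num

theorem matX_mem : matX ∈ Matrix.unitaryGroup (Fin 2) ℂ := by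
  rw [Matrix.mem_unitaryGroup_iff]
  ext i j
  fin_cases i <;> fin_cases j <;> simp [matX, Matrix.mul_apply, Fin.sum_univ_two]

theorem matZ_mem : matZ ∈ Matrix.unitaryGroup (Fin 2) ℂ := by
  rw [Matrix.mem_unitaryGroup_iff]
  ext i j
  fin_cases i <;> fin_cases j <;> simp [matZ, Matrix.mul_apply, Fin.sum_univ_two]

theorem sqrt_two_sq : ((Real.sqrt 2 : ℂ))⁻¹ * ((Real.sqrt 2 : ℂ))⁻¹ = 1 / 2 := by
  rw [← mul_inv, ← Complex.ofReal_mul, Real.mul_self_sqrt (by norm_num)]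
  norm_num

theorem matH_mul_self : matH * matH = 1 := by
  have h := sqrt_two_sq
  ext i j
  fin_cases i <;> fin_cases j <;>
    simp [matH, Matrix.mul_apply, Fin.sum_univ_two, h] <;> norm_num

theorem matH_mem : matH ∈ Matrix.unitaryGroup (Fin 2) ℂ := by
  have h : star matH = matH := by
    ext i j
    fin_cases i <;> fin_cases j <;> simp [matH, Matrix.star_apply]
  rw [Matrix.mem_unitaryGroup_iff, h, matH_mul_self]

theorem matS_mem (ω : EighthRoot) : matS ω ∈ Matrix.unitaryGroup (Fin 2) ℂ := by
  have h := ω.mul_star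
  rw [map_pow] at h
  rw [Matrix.mem_unitaryGroup_iff]
  ext i j
  fin_cases i <;> fin_cases j <;> simp [matS, Matrix.mul_apply, Fin.sum_univ_two, h]

theorem matCZ_mul_self {n : ℕ} (i j : Fin n) : matCZ i j * matCZ i j = 1 := by
  rw [matCZ, Matrix.diagonal_mul_diagonal, ← Matrix.diagonal_one]
  congr 1
  funext x
  split_ifs <;> norm_num

theorem matCZ_mem {n : ℕ} (i j : Fin n) : matCZ i j ∈ Matrix.unitaryGroup (Basis n) ℂ := by
  have h : star (matCZ i j) = matCZ i j := by
    rw [matCZ, Matrix.star_eq_conjTranspose, Matrix.diagonal_conjTranspose]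
    congr 1
    funext x
    simp only [Pi.star_apply]
    split_ifs <;> simp
  rw [Matrix.mem_unitaryGroup_iff, h, matCZ_mul_self]

/-- The unitary gate `X` on qubit `i`. -/
def gateX {n : ℕ} (i : Fin n) : U n := ⟨onQubit i matX, onQubit_mem i matX_mem⟩

/-- The unitary gate `Z` on qubit `i`. -/
def gateZ {n : ℕ} (i : Fin n) : U n := ⟨onQubit i matZ, onQubit_mem i matZ_mem⟩

/-- The Hadamard gate on qubit `i`. -/
def gateH {n : ℕ} (i : Fin n) : U n := ⟨onQubit i matH, onQubit_mem i matH_mem⟩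

/-- The phase gate on qubit `i`. -/
def gateS (ω : EighthRoot) {n : ℕ} (i : Fin n) : U n := ⟨onQubit i (matS ω), onQubit_mem i (matS_mem ω)⟩

/-- The controlled `Z` gate on the qubits `i` and `j`. -/
def gateCZ {n : ℕ} (i j : Fin n) : U n := ⟨matCZ i j, matCZ_mem i j⟩

/-- The scalar matrix `ω² I`. -/
def gateScalar (ω : EighthRoot) (n : ℕ) : U n :=
  ⟨((ω : ℂ) ^ 2) • 1, by
    rw [Matrix.mem_unitaryGroup_iff, star_smul, star_one, smul_mul_smul_comm, one_mul]
    have h := ω.mul_star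
    rw [starRingEnd_apply] at h
    rw [h, one_smul]⟩

/-! ### The Pauli group, the Clifford group and the projective Clifford group -/

/-- The `n`-qubit Pauli group. -/
def Pauli (ω : EighthRoot) (n : ℕ) : Subgroup (U n) :=
  Subgroup.closure (Set.range gateX ∪ Set.range gateZ ∪ {gateScalar ω n})

/-- The `n`-qubit Clifford group: the normalizer of the Pauli group in the unitary group. -/
def Clifford (ω : EighthRoot) (n : ℕ) : Subgroup (U n) :=
  Subgroup.normalizer (Pauli ω n : Set (U n))

/-- The group of global phases: the unitary scalar matrices. -/
def phases (n : ℕ) : Subgroup (U n) where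
  carrier := {A | ∃ c : ℂ, (A : Matrix (Basis n) (Basis n) ℂ) = c • 1}
  one_mem' := ⟨1, by simp⟩
  mul_mem' := by
    rintro A B ⟨a, ha⟩ ⟨b, hb⟩
    exact ⟨a * b, by rw [Submonoid.coe_mul, ha, hb, smul_mul_smul_comm, one_mul]⟩
  inv_mem' := by
    rintro A ⟨a, ha⟩
    exact ⟨star a, by rw [Matrix.UnitaryGroup.inv_val, ha, star_smul, star_one]⟩

instance phases_normal (n : ℕ) : (phases n).Normal where
  conj_mem := by
    rintro A ⟨a, ha⟩ B
    refine ⟨a, ?_⟩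
    have h : B * A * B⁻¹ = A := by
      rw [mul_inv_eq_iff_eq_mul]
      apply Subtype.ext
      rw [Submonoid.coe_mul, Submonoid.coe_mul, ha]
      simp
    rw [h, ha]

/-- The `n`-qubit projective Clifford group: the Clifford group modulo global phases. Products are
written from left to right, as for circuits; this is the opposite of matrix multiplication. -/
abbrev ProjClifford (ω : EighthRoot) (n : ℕ) : Type :=
  (Clifford ω n ⧸ (phases n).subgroupOf (Clifford ω n))ᵐᵒᵖ

/-- The class of a Clifford operator in the projective Clifford group. -/
def toProj {ω : EighthRoot} {n : ℕ} (A : Clifford ω n) : ProjClifford ω n :=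
  MulOpposite.op (QuotientGroup.mk A)

theorem gateX_mem_pauli (ω : EighthRoot) {n : ℕ} (i : Fin n) : gateX i ∈ Pauli ω n :=
  Subgroup.subset_closure (Or.inl (Or.inl ⟨i, rfl⟩))

theorem gateZ_mem_pauli (ω : EighthRoot) {n : ℕ} (i : Fin n) : gateZ i ∈ Pauli ω n :=
  Subgroup.subset_closure (Or.inl (Or.inr ⟨i, rfl⟩))

theorem gateScalar_mem_pauli (ω : EighthRoot) (n : ℕ) : gateScalar ω n ∈ Pauli ω n :=
  Subgroup.subset_closure (Or.inr rfl)

theorem gateScalar_comm (ω : EighthRoot) {n : ℕ} (A : U n) :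
    A * gateScalar ω n = gateScalar ω n * A := by
  apply Subtype.ext
  simp [gateScalar]

/-- A unitary of order dividing four is a Clifford operator if it conjugates the `X` and `Z`
generators into the Pauli group. -/
theorem mem_clifford_of_gen (ω : EighthRoot) {n : ℕ} (A : U n) (h4 : A ^ 4 = 1)
    (hX : ∀ i, ∃ P ∈ Pauli ω n, A * gateX i = P * A)
    (hZ : ∀ i, ∃ P ∈ Pauli ω n, A * gateZ i = P * A) : A ∈ Clifford ω n := by
  have key : ∀ P ∈ Pauli ω n, A * P * A⁻¹ ∈ Pauli ω n := by
    have hle : Pauli ω n ≤ (Pauli ω n).comap (MulAut.conj A).toMonoidHom := by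
      conv_lhs => rw [Pauli]
      rw [Subgroup.closure_le]
      rintro B ((⟨i, rfl⟩ | ⟨i, rfl⟩) | rfl)
      · obtain ⟨P, hP, h⟩ := hX i
        change A * gateX i * A⁻¹ ∈ Pauli ω n
        rwa [h, mul_inv_cancel_right]
      · obtain ⟨P, hP, h⟩ := hZ i
        change A * gateZ i * A⁻¹ ∈ Pauli ω n
        rwa [h, mul_inv_cancel_right]
      · change A * gateScalar ω n * A⁻¹ ∈ Pauli ω n
        rw [gateScalar_comm, mul_inv_cancel_right]
        exact gateScalar_mem_pauli ω n
    exact fun P hP => hle hP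
  rw [Clifford, Subgroup.mem_normalizer_iff]
  intro P
  refine ⟨key P, fun hP => ?_⟩
  have h := key _ (key _ (key _ hP))
  have e : A * (A * (A * (A * P * A⁻¹) * A⁻¹) * A⁻¹) * A⁻¹ = A ^ 4 * P * (A ^ 4)⁻¹ := by
    simp only [pow_succ, pow_zero, one_mul, _root_.mul_inv_rev, mul_assoc]
  rw [e, h4] at h
  simpa using h

theorem gateH_mem (ω : EighthRoot) {n : ℕ} (i : Fin n) : gateH i ∈ Clifford ω n := by
  have e1 : matH * matX = matZ * matH := by
    ext a b
    fin_cases a <;> fin_cases b <;>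
      simp [matH, matX, matZ, Matrix.mul_apply, Fin.sum_univ_two]
  have e2 : matH * matZ = matX * matH := by
    ext a b
    fin_cases a <;> fin_cases b <;>
      simp [matH, matX, matZ, Matrix.mul_apply, Fin.sum_univ_two]
  have h2 : gateH i * gateH i = (1 : U n) := Subtype.ext (by
    change onQubit i matH * onQubit i matH = 1
    rw [onQubit_mul, matH_mul_self, onQubit_one])
  refine mem_clifford_of_gen ω _ ?_ (fun j => ?_) (fun j => ?_)
  · rw [show (4 : ℕ) = 2 * 2 from rfl, pow_mul, pow_two (gateH i), h2, one_pow]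
  · by_cases hij : i = j
    · subst hij
      refine ⟨gateZ i, gateZ_mem_pauli ω i, Subtype.ext ?_⟩
      change onQubit i matH * onQubit i matX = onQubit i matZ * onQubit i matH
      rw [onQubit_mul, onQubit_mul, e1]
    · exact ⟨gateX j, gateX_mem_pauli ω j, Subtype.ext (onQubit_comm hij _ _)⟩
  · by_cases hij : i = j
    · subst hij
      refine ⟨gateX i, gateX_mem_pauli ω i, Subtype.ext ?_⟩
      change onQubit i matH * onQubit i matZ = onQubit i matX * onQubit i matH
      rw [onQubit_mul, onQubit_mul, e2]
    · exact ⟨gateZ j, gateZ_mem_pauli ω j, Subtype.ext (onQubit_comm hij _ _)⟩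

theorem gateS_mem (ω : EighthRoot) {n : ℕ} (i : Fin n) : gateS ω i ∈ Clifford ω n := by
  have hω := ω.pow_four
  have e1 : matS ω * matX = (((ω : ℂ) ^ 2) • (matX * matZ)) * matS ω := by
    ext a b
    fin_cases a <;> fin_cases b <;>
      simp [matS, matX, matZ, Matrix.mul_apply, Fin.sum_univ_two]
    linear_combination hω
  have e2 : matS ω * matZ = matZ * matS ω := by
    ext a b
    fin_cases a <;> fin_cases b <;>
      simp [matS, matZ, Matrix.mul_apply, Fin.sum_univ_two]
  have e4 : (matS ω * matS ω) * (matS ω * matS ω) = 1 := by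
    ext a b
    fin_cases a <;> fin_cases b <;>
      simp [matS, Matrix.mul_apply, Fin.sum_univ_two]
    linear_combination ((ω : ℂ) ^ 4 - 1) * hω
  refine mem_clifford_of_gen ω _ ?_ (fun j => ?_) (fun j => ?_)
  · have h : gateS ω i ^ 4 = (gateS ω i * gateS ω i) * (gateS ω i * gateS ω i) := by
      rw [show (4 : ℕ) = 2 * 2 from rfl, pow_mul, pow_two, pow_two]
    rw [h]
    refine Subtype.ext ?_
    change (onQubit i (matS ω) * onQubit i (matS ω)) * (onQubit i (matS ω) * onQubit i (matS ω)) = 1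
    rw [onQubit_mul, onQubit_mul, e4, onQubit_one]
  · by_cases hij : i = j
    · subst hij
      refine ⟨gateScalar ω n * (gateX i * gateZ i), mul_mem (gateScalar_mem_pauli ω n)
        (mul_mem (gateX_mem_pauli ω i) (gateZ_mem_pauli ω i)), Subtype.ext ?_⟩
      change onQubit i (matS ω) * onQubit i matX =
        (((ω : ℂ) ^ 2) • 1 * (onQubit i matX * onQubit i matZ)) * onQubit i (matS ω)
      rw [onQubit_mul, onQubit_mul, smul_mul_assoc, one_mul, ← onQubit_smul, onQubit_mul, e1]
    · exact ⟨gateX j, gateX_mem_pauli ω j, Subtype.ext (onQubit_comm hij _ _)⟩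
  · by_cases hij : i = j
    · subst hij
      refine ⟨gateZ i, gateZ_mem_pauli ω i, Subtype.ext ?_⟩
      change onQubit i (matS ω) * onQubit i matZ = onQubit i matZ * onQubit i (matS ω)
      rw [onQubit_mul, onQubit_mul, e2]
    · exact ⟨gateZ j, gateZ_mem_pauli ω j, Subtype.ext (onQubit_comm hij _ _)⟩

theorem matCZ_comm {n : ℕ} (i j : Fin n) : matCZ i j = matCZ j i := by
  simp only [matCZ, and_comm]

theorem onQubit_matZ {n : ℕ} (i : Fin n) :
    onQubit i matZ = Matrix.diagonal fun x : Basis n => if x i = 1 then (-1 : ℂ) else 1 := by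
  ext x y
  rw [onQubit_apply, Matrix.diagonal_apply]
  by_cases hxy : x = y
  · subst hxy
    have : ∀ a : Fin 2, matZ a a = if a = 1 then (-1 : ℂ) else 1 := by
      intro a
      fin_cases a <;> simp [matZ]
    simp [this]
  · rw [if_neg hxy]
    split_ifs with h
    · have hne : x i ≠ y i := fun hi => hxy (funext fun k => by
        by_cases hk : k = i
        · exact hk ▸ hi
        · exact h k hk)
      have : ∀ a b : Fin 2, a ≠ b → matZ a b = 0 := by
        intro a b
        fin_cases a <;> fin_cases b <;> simp [matZ]
      exact this _ _ hne
    · rfl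

theorem matCZ_matX {n : ℕ} {i j : Fin n} (hij : i ≠ j) :
    matCZ i j * onQubit i matX = onQubit i matX * onQubit j matZ * matCZ i j := by
  ext x y
  rw [onQubit_matZ, matCZ, Matrix.diagonal_mul, Matrix.mul_diagonal, Matrix.mul_diagonal,
    onQubit_apply]
  by_cases hk : ∀ k, k ≠ i → x k = y k
  · rw [if_pos hk, hk j hij.symm]
    have key : ∀ a b c : Fin 2, (if a = 1 ∧ c = 1 then (-1 : ℂ) else 1) * matX a b =
        matX a b * (if c = 1 then (-1 : ℂ) else 1) * (if b = 1 ∧ c = 1 then (-1 : ℂ) else 1) := by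
      intro a b c
      fin_cases a <;> fin_cases b <;> fin_cases c <;> simp [matX]
    exact key _ _ _
  · simp [if_neg hk]

theorem gateCZ_mem (ω : EighthRoot) {n : ℕ} {i j : Fin n} (hij : i ≠ j) :
    gateCZ i j ∈ Clifford ω n := by
  have h2 : gateCZ i j * gateCZ i j = (1 : U n) := Subtype.ext (matCZ_mul_self i j)
  refine mem_clifford_of_gen ω _ ?_ (fun k => ?_) (fun k => ?_)
  · rw [show (4 : ℕ) = 2 * 2 from rfl, pow_mul, pow_two (gateCZ i j), h2, one_pow]
  · by_cases hi : k = i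
    · subst hi
      exact ⟨gateX k * gateZ j, mul_mem (gateX_mem_pauli ω k) (gateZ_mem_pauli ω j),
        Subtype.ext (matCZ_matX hij)⟩
    · by_cases hj : k = j
      · subst hj
        refine ⟨gateX k * gateZ i, mul_mem (gateX_mem_pauli ω k) (gateZ_mem_pauli ω i),
          Subtype.ext ?_⟩
        change matCZ i k * onQubit k matX = onQubit k matX * onQubit i matZ * matCZ i k
        rw [matCZ_comm i k]
        exact matCZ_matX hi
      · refine ⟨gateX k, gateX_mem_pauli ω k, Subtype.ext ?_⟩
        change matCZ i j * onQubit k matX = onQubit k matX * matCZ i j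
        ext x y
        rw [matCZ, Matrix.diagonal_mul, Matrix.mul_diagonal, onQubit_apply]
        by_cases hk : ∀ l, l ≠ k → x l = y l
        · rw [if_pos hk, hk i (Ne.symm hi), hk j (Ne.symm hj), mul_comm]
        · simp [if_neg hk]
  · refine ⟨gateZ k, gateZ_mem_pauli ω k, Subtype.ext ?_⟩
    change matCZ i j * onQubit k matZ = onQubit k matZ * matCZ i j
    rw [onQubit_matZ, matCZ, Matrix.diagonal_mul_diagonal, Matrix.diagonal_mul_diagonal]
    congr 1
    funext x
    exact mul_comm _ _

/-! ### The generators and the subgroups -/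

/-- The class of the Hadamard gate on qubit `i`. -/
def h (ω : EighthRoot) {n : ℕ} (i : Fin n) : ProjClifford ω n := toProj ⟨gateH i, gateH_mem ω i⟩

/-- The class of the phase gate on qubit `i`. -/
def s (ω : EighthRoot) {n : ℕ} (i : Fin n) : ProjClifford ω n :=
  toProj ⟨gateS ω i, gateS_mem ω i⟩

/-- The class of the controlled `Z` gate on the adjacent qubits `i` and `i + 1`. -/
def lam (ω : EighthRoot) {n : ℕ} (i : Fin n) (hi : (i : ℕ) + 1 < n) : ProjClifford ω n :=
  toProj ⟨gateCZ i ⟨i + 1, hi⟩, gateCZ_mem ω (Fin.ne_of_val_ne (Nat.succ_ne_self _).symm)⟩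

/-- The element `h₂ Λ₁ s₂² h₂ h₁ s₁² h₂ Λ₁ h₂`, with the usual numbering of the qubits. -/
def M (ω : EighthRoot) (n : ℕ) : ProjClifford ω (n + 2) :=
  h ω 1 * lam ω 0 (by simp) * s ω 1 ^ 2 * h ω 1 * h ω 0 * s ω 0 ^ 2 * h ω 1 * lam ω 0 (by simp) *
    h ω 1

/-- The gates `h_i`, `s_i` and `Λ_i` for all qubits `i` except the first one. -/
def tailGates (ω : EighthRoot) (n : ℕ) : Set (ProjClifford ω n) :=
  {g | ∃ i : Fin n, (i : ℕ) ≠ 0 ∧ (g = h ω i ∨ g = s ω i ∨ ∃ hi, g = lam ω i hi)}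

/-- The inertia subgroup, given by generators. -/
def IN (ω : EighthRoot) : (n : ℕ) → Subgroup (ProjClifford ω n)
  | 0 => ⊥
  | 1 => Subgroup.closure {h ω 0, s ω 0 ^ 3 * h ω 0 * s ω 0 * h ω 0 * s ω 0}
  | 2 => Subgroup.closure {h ω 0, h ω 1, s ω 1, h ω 0 * s ω 0 ^ 2 * h ω 0, M ω 0}
  | n + 3 => Subgroup.closure ({h ω 0, M ω (n + 1)} ∪ tailGates ω (n + 3))

/-- The subgroup `F` of the inertia subgroup, given by generators. -/
def F (ω : EighthRoot) : (n : ℕ) → Subgroup (ProjClifford ω n)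
  | 0 => ⊥
  | 1 => Subgroup.closure {s ω 0 ^ 3 * h ω 0 * s ω 0 * h ω 0 * s ω 0}
  | 2 => Subgroup.closure {h ω 1, s ω 1, s ω 0 ^ 3 * h ω 0 * s ω 0 * h ω 0 * s ω 0, M ω 0}
  | n + 3 => Subgroup.closure ({M ω (n + 1)} ∪ tailGates ω (n + 3))

end

end QubitClifford

namespace QubitClifford

noncomputable section

/-! ### Hermitian Pauli operators -/

/-! Pauli operators up to phase form the symplectic space of dimension `2n` over the field with two
elements (`Label`, `sp`), and a Clifford operator is determined modulo phases by its action on the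
signed hermitian Paulis `W`. Write `i = ω²`. Every hermitian Pauli `W v` has the Clifford square
root `R v` with eigenvalues `1` and `i`; it acts on labels as the symplectic transvection along `v`
(`R_commute`, `R_moves_of_sp_eq_one`). The gate `S` is `R (lz i)`, and `H` and `CZ` are words in
such roots up to phases (`Z_mul_H_mul_R`, `gateCZ_mul_R`).

An operator commuting with the first phase gate up to a phase commutes with it exactly, so the
centralizer consists of the Cliffords commuting with `Z` on the first qubit, index `0`
(`mem_lift_centralizer`). A Witt-type argument, correcting an operator by transvections one qubit at
a time, shows that these are generated modulo phases by the `R v` with `v` orthogonal to `lz 0`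
(`mem_of_fixes_lz`).

It remains to decide which `R v` lie in a subgroup. If `R v` and `R w` do and `v`, `w` anticommute,
then so does `R (v + w)` (`R_add_mem`). The gates on the other qubits thereby yield every `R v` with
`v` trivial on the first qubit, after which `R (lz 0)` and, from two qubits on, one further `R (lz 0
+ t)` suffice (`mem_of_fixes_lz_of_generators`). For the standard gates, `R (lz 0)` is an explicit
word (`R_lz_zero_mem`), which makes `s₁` redundant.

For `F`, conjugate by `c = h₁s₁`. This fixes the gates on the other qubits, sends `sqrtY` to `s₁`,
and sends `M` to a square root of `Z ⊗ X` up to a Pauli (`conj_M_mem_iff`). For at least three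
qubits `sqrtY` is not among the generators, but a relation between diagonal roots recovers `s₁`
(`s_zero_mem`). Hence `c F c⁻¹` is the centralizer of `s₁`, and `F` is the centralizer of `sqrtY`.
Finally `IN` is generated by `F` and `h₁`, and `h₁` is an involution inverting the order-four
element `sqrtY`, so the index is two (`centralizer_index_two`). -/

/-- Labels of the `n`-qubit Pauli operators up to sign: on each qubit a pair of bits. -/
abbrev Label (n : ℕ) : Type := Fin n → ZMod 2 × ZMod 2

/-- The hermitian one-qubit Pauli matrix with a given label. -/
def sigma (ω : EighthRoot) (a : ZMod 2 × ZMod 2) : Matrix (Fin 2) (Fin 2) ℂ :=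
  if a = (0, 0) then 1 else if a = (1, 0) then matX else if a = (0, 1) then matZ
  else ((ω : ℂ) ^ 2) • (matX * matZ)

/-- The local symplectic form. -/
def localForm (a b : ZMod 2 × ZMod 2) : ZMod 2 := a.1 * b.2 + a.2 * b.1

/-- The symplectic form on labels. -/
def sp {n : ℕ} (v w : Label n) : ZMod 2 := ∑ k, localForm (v k) (w k)

/-- The sign `(-1) ^ a` of a bit. -/
def sgn (a : ZMod 2) : ℂ := if a = 0 then 1 else -1

theorem zmod_two_cases (a : ZMod 2) : a = 0 ∨ a = 1 := by
  revert a; decide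

theorem sgn_add (a b : ZMod 2) : sgn (a + b) = sgn a * sgn b := by
  have h11 : (1 + 1 : ZMod 2) = 0 := by decide
  rcases zmod_two_cases a with rfl | rfl <;> rcases zmod_two_cases b with rfl | rfl <;>
    simp [sgn, h11]

theorem sgn_sum {ι : Type*} (t : Finset ι) (f : ι → ZMod 2) :
    sgn (∑ k ∈ t, f k) = ∏ k ∈ t, sgn (f k) := by
  classical
  induction t using Finset.induction_on with
  | empty => simp [sgn]
  | insert a t ha ih => rw [Finset.sum_insert ha, Finset.prod_insert ha, sgn_add, ih]

theorem pair_cases (a : ZMod 2 × ZMod 2) :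
    a = (0, 0) ∨ a = (1, 0) ∨ a = (0, 1) ∨ a = (1, 1) := by
  revert a; decide

theorem sigma_zero_zero (ω : EighthRoot) : sigma ω (0, 0) = 1 := by simp [sigma]

theorem sigma_zero (ω : EighthRoot) : sigma ω 0 = 1 := sigma_zero_zero ω

theorem sigma_x (ω : EighthRoot) : sigma ω (1, 0) = matX := by simp [sigma]

theorem sigma_z (ω : EighthRoot) : sigma ω (0, 1) = matZ := by simp [sigma]

theorem sigma_y (ω : EighthRoot) : sigma ω (1, 1) = ((ω : ℂ) ^ 2) • (matX * matZ) := by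
  simp [sigma]

theorem EighthRoot.sq_sq (ω : EighthRoot) : (ω : ℂ) ^ 2 * (ω : ℂ) ^ 2 = -1 := by
  rw [← pow_add]; exact ω.pow_four

theorem EighthRoot.star_sq (ω : EighthRoot) : star ((ω : ℂ) ^ 2) = -((ω : ℂ) ^ 2) := by
  have h1 := ω.mul_star
  have h2 := ω.sq_sq
  rw [starRingEnd_apply] at h1
  linear_combination (-(ω : ℂ) ^ 2) * h1 + star ((ω : ℂ) ^ 2) * h2

theorem matX_mul_self : matX * matX = 1 := by
  ext i j; fin_cases i <;> fin_cases j <;> simp [matX, Matrix.mul_apply, Fin.sum_univ_two]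

theorem matZ_mul_self : matZ * matZ = 1 := by
  ext i j; fin_cases i <;> fin_cases j <;> simp [matZ, Matrix.mul_apply, Fin.sum_univ_two]

theorem matZ_mul_matX : matZ * matX = -(matX * matZ) := by
  ext i j; fin_cases i <;> fin_cases j <;> simp [matX, matZ, Matrix.mul_apply, Fin.sum_univ_two]

theorem star_matX : star matX = matX := by
  ext i j; fin_cases i <;> fin_cases j <;> simp [matX, Matrix.star_apply]

theorem star_matZ : star matZ = matZ := by
  ext i j; fin_cases i <;> fin_cases j <;> simp [matZ, Matrix.star_apply]

theorem star_sigma (ω : EighthRoot) (a : ZMod 2 × ZMod 2) : star (sigma ω a) = sigma ω a := by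
  rcases pair_cases a with rfl | rfl | rfl | rfl
  · rw [sigma_zero_zero, star_one]
  · rw [sigma_x, star_matX]
  · rw [sigma_z, star_matZ]
  · rw [sigma_y, star_smul, star_mul, star_matX, star_matZ, ω.star_sq, matZ_mul_matX, smul_neg,
      neg_smul, neg_neg]

theorem sigma_mul_self (ω : EighthRoot) (a : ZMod 2 × ZMod 2) : sigma ω a * sigma ω a = 1 := by
  rcases pair_cases a with rfl | rfl | rfl | rfl
  · rw [sigma_zero_zero, one_mul]
  · rw [sigma_x, matX_mul_self]
  · rw [sigma_z, matZ_mul_self]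
  · rw [sigma_y, smul_mul_smul_comm, ω.sq_sq, mul_assoc matX, ← mul_assoc matZ, matZ_mul_matX,
      neg_mul, mul_assoc, matZ_mul_self, mul_one, mul_neg, matX_mul_self, smul_neg, neg_smul,
      neg_neg, one_smul]

theorem sigma_mul (ω : EighthRoot) (a b : ZMod 2 × ZMod 2) : ∃ c : ℂ, c ≠ 0 ∧
    sigma ω a * sigma ω b = c • sigma ω (a + b) := by
  have hω : (ω : ℂ) ^ 2 ≠ 0 := fun h0 => by simpa [h0] using ω.sq_sq
  have h11 : (1 + 1 : ZMod 2) = 0 := by decide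
  have hzx := matZ_mul_matX
  have hxx := matX_mul_self
  have hzz := matZ_mul_self
  have hι := ω.sq_sq
  have hxxz : matX * (matX * matZ) = matZ := by rw [← mul_assoc, hxx, one_mul]
  have hzxz : matZ * (matX * matZ) = -matX := by rw [← mul_assoc, hzx, neg_mul, mul_assoc, hzz,
    mul_one]
  have hyy := sigma_mul_self ω (1, 1)
  rw [sigma_y] at hyy
  rcases pair_cases a with rfl | rfl | rfl | rfl <;> rcases pair_cases b with rfl | rfl | rfl | rfl
  all_goals simp only [Prod.mk_add_mk, add_zero, zero_add, h11, sigma_zero_zero, sigma_x, sigma_y,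
    sigma_z, one_mul, mul_one, hxx, hzz, hzx, mul_smul_comm, smul_mul_assoc, hxxz, hzxz,
    mul_assoc, mul_neg, smul_neg]
  -- Two distinct non-identity hermitian Paulis multiply to `±ω²` times the third; all other
  -- products have scalar `1`.
  all_goals first
    | (refine ⟨1, one_ne_zero, ?_⟩; simp [smul_smul, hι]; done)
    | (refine ⟨(ω : ℂ) ^ 2, hω, ?_⟩; simp [smul_smul, hι]; done)
    | (refine ⟨-(ω : ℂ) ^ 2, neg_ne_zero.mpr hω, ?_⟩; simp [smul_smul, hι])

theorem sigma_comm (ω : EighthRoot) (a b : ZMod 2 × ZMod 2) :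
    sigma ω a * sigma ω b = sgn (localForm a b) • (sigma ω b * sigma ω a) := by
  have h11 : (1 + 1 : ZMod 2) = 0 := by decide
  have hzx := matZ_mul_matX
  have hxx := matX_mul_self
  have hzz := matZ_mul_self
  have hxxz : matX * (matX * matZ) = matZ := by rw [← mul_assoc, hxx, one_mul]
  have hzxz : matZ * (matX * matZ) = -matX := by rw [← mul_assoc, hzx, neg_mul, mul_assoc, hzz,
    mul_one]
  rcases pair_cases a with rfl | rfl | rfl | rfl <;> rcases pair_cases b with rfl | rfl | rfl | rfl
  all_goals simp [localForm, sgn, h11, sigma_zero_zero, sigma_x, sigma_y,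
    sigma_z, hxx, hzz, hzx, hxxz, hzxz, mul_assoc]

theorem tensorMat_smul {n : ℕ} (c : Fin n → ℂ) (f : Fin n → Matrix (Fin 2) (Fin 2) ℂ) :
    tensorMat (fun k => c k • f k) = (∏ k, c k) • tensorMat f := by
  ext x y
  simp [tensorMat, Finset.prod_mul_distrib]

/-- The hermitian Pauli operator with a given label. -/
def W (ω : EighthRoot) {n : ℕ} (v : Label n) : U n :=
  ⟨tensorMat fun k => sigma ω (v k), by
    rw [Matrix.mem_unitaryGroup_iff, tensorMat_star, tensorMat_mul, ← tensorMat_one]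
    congr 1
    funext k
    rw [star_sigma, sigma_mul_self]⟩

variable {ω : EighthRoot} {n : ℕ}

theorem coe_W (v : Label n) :
    (W ω v : Matrix (Basis n) (Basis n) ℂ) = tensorMat fun k => sigma ω (v k) := rfl

theorem W_zero : W ω (0 : Label n) = 1 := by
  apply Subtype.ext
  rw [coe_W]
  simp only [Pi.zero_apply, sigma_zero, tensorMat_one]
  rfl

theorem W_mul_self (v : Label n) : W ω v * W ω v = 1 := by
  apply Subtype.ext
  rw [Submonoid.coe_mul, coe_W, tensorMat_mul]
  simp only [sigma_mul_self, tensorMat_one]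
  rfl

theorem W_inv (v : Label n) : (W ω v)⁻¹ = W ω v := inv_eq_of_mul_eq_one_left (W_mul_self v)

theorem W_mul (v w : Label n) : ∃ c : ℂ, c ≠ 0 ∧
    (W ω v * W ω w : Matrix (Basis n) (Basis n) ℂ) = c • (W ω (v + w)).1 := by
  choose c hc h using fun k => sigma_mul ω (v k) (w k)
  refine ⟨∏ k, c k, Finset.prod_ne_zero_iff.mpr fun k _ => hc k, ?_⟩
  rw [coe_W, coe_W, coe_W, tensorMat_mul, ← tensorMat_smul]
  simp only [h, Pi.add_apply]

theorem W_mul_of_disjoint {v w : Label n} (hvw : ∀ k, v k = 0 ∨ w k = 0) :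
    W ω v * W ω w = W ω (v + w) := by
  apply Subtype.ext
  rw [Submonoid.coe_mul, coe_W, coe_W, coe_W, tensorMat_mul]
  congr 1
  funext k
  rcases hvw k with h0 | h0 <;> simp [h0, sigma_zero]

theorem W_comm (v w : Label n) :
    (W ω v * W ω w : Matrix (Basis n) (Basis n) ℂ) = sgn (sp v w) • (W ω w * W ω v).1 := by
  rw [Submonoid.coe_mul, coe_W, coe_W, tensorMat_mul, tensorMat_mul, sp, sgn_sum, ← tensorMat_smul]
  simp only [← sigma_comm]

theorem commute_W {v w : Label n} (hvw : sp v w = 0) : W ω v * W ω w = W ω w * W ω v := by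
  apply Subtype.ext
  rw [Submonoid.coe_mul, W_comm, hvw]
  simp [sgn]

theorem anticommute_W {v w : Label n} (hvw : sp v w = 1) :
    W ω v * W ω w = -(W ω w * W ω v) := by
  apply Subtype.ext
  rw [Submonoid.coe_mul, W_comm, hvw, Unitary.coe_neg]
  simp [sgn]

/-! ### The symplectic form -/

theorem localForm_comm (a b : ZMod 2 × ZMod 2) : localForm a b = localForm b a := by
  revert a b; decide

theorem localForm_add_left (a b c : ZMod 2 × ZMod 2) :
    localForm (a + b) c = localForm a c + localForm b c := by
  revert a b c; decide

theorem localForm_self (a : ZMod 2 × ZMod 2) : localForm a a = 0 := by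
  revert a; decide

theorem sp_comm (v w : Label n) : sp v w = sp w v := by
  simp only [sp, localForm_comm]

theorem sp_add_left (u v w : Label n) : sp (u + v) w = sp u w + sp v w := by
  simp only [sp, Pi.add_apply, localForm_add_left, Finset.sum_add_distrib]

theorem sp_add_right (u v w : Label n) : sp u (v + w) = sp u v + sp u w := by
  rw [sp_comm, sp_add_left, sp_comm v, sp_comm w]

theorem sp_self (v : Label n) : sp v v = 0 := by
  simp [sp, localForm_self]

theorem sp_single (v : Label n) (i : Fin n) (a : ZMod 2 × ZMod 2) :
    sp v (Pi.single i a) = localForm (v i) a := by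
  rw [sp, Finset.sum_eq_single i]
  · simp
  · intro k _ hk
    simp [Pi.single_eq_of_ne hk, localForm]
  · simp

theorem sp_single_left (v : Label n) (i : Fin n) (a : ZMod 2 × ZMod 2) :
    sp (Pi.single i a) v = localForm a (v i) := by
  rw [sp_comm, sp_single, localForm_comm]

theorem label_add_self (v : Label n) : v + v = 0 := by
  funext k
  have : ∀ a : ZMod 2 × ZMod 2, a + a = 0 := by decide
  exact this (v k)

theorem label_add_add (v w : Label n) : v + (v + w) = w := by
  rw [← add_assoc, label_add_self, zero_add]

theorem label_add_eq_zero {v w : Label n} : v + w = 0 ↔ v = w := by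
  constructor
  · intro h0
    rw [← label_add_add v w, h0, add_zero]
  · rintro rfl
    exact label_add_self v

theorem add_ne_zero_of_sp {v w : Label n} (hvw : sp v w = 1) : v + w ≠ 0 := by
  rw [Ne, label_add_eq_zero]
  rintro rfl
  simp [sp_self] at hvw

/-- The label is trivial on the first `k` qubits. -/
def SuppGE (k : ℕ) (v : Label n) : Prop := ∀ i : Fin n, (i : ℕ) < k → v i = 0

theorem SuppGE.add {k : ℕ} {v w : Label n} (hv : SuppGE k v) (hw : SuppGE k w) :
    SuppGE k (v + w) := fun i hi => by rw [Pi.add_apply, hv i hi, hw i hi, add_zero]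

theorem suppGE_zero (v : Label n) : SuppGE 0 v := fun _ hi => absurd hi (Nat.not_lt_zero _)

theorem SuppGE.mono {k l : ℕ} (hkl : l ≤ k) {v : Label n} (hv : SuppGE k v) : SuppGE l v :=
  fun i hi => hv i (hi.trans_le hkl)

theorem suppGE_single {k : ℕ} {i : Fin n} (hi : k ≤ i) (a : ZMod 2 × ZMod 2) :
    SuppGE k (Pi.single i a) := fun j hj => by
  rw [Pi.single_eq_of_ne]
  rintro rfl
  exact absurd hj (not_lt.mpr hi)

theorem exists_sp_eq_one {k : ℕ} {v : Label n} (hv : SuppGE k v) (h0 : v ≠ 0) :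
    ∃ w, SuppGE k w ∧ sp v w = 1 := by
  obtain ⟨i, hi⟩ := Function.ne_iff.mp h0
  have hki : k ≤ i := by
    by_contra hlt
    exact hi (hv i (not_le.mp hlt))
  have : ∀ a : ZMod 2 × ZMod 2, a ≠ 0 → ∃ b, localForm a b = 1 := by decide
  obtain ⟨b, hb⟩ := this (v i) hi
  exact ⟨Pi.single i b, suppGE_single hki b, by rw [sp_single, hb]⟩

/-- A vector space is not the union of the two hyperplanes orthogonal to `u` and to `v`. The
resulting `w` is the intermediate point through which two steps along anticommuting labels join `u`
to `v`. -/
theorem exists_sp_eq_one_pair {k : ℕ} {u v : Label n} (hu : SuppGE k u) (hu0 : u ≠ 0)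
    (hv : SuppGE k v) (hv0 : v ≠ 0) : ∃ w, SuppGE k w ∧ sp u w = 1 ∧ sp v w = 1 := by
  obtain ⟨a, ha, hua⟩ := exists_sp_eq_one hu hu0
  obtain ⟨b, hb, hvb⟩ := exists_sp_eq_one hv hv0
  rcases zmod_two_cases (sp v a) with hva | hva
  · rcases zmod_two_cases (sp u b) with hub | hub
    · exact ⟨a + b, ha.add hb, by simp [sp_add_right, hua, hub], by simp [sp_add_right, hva, hvb]⟩
    · exact ⟨b, hb, hub, hvb⟩
  · exact ⟨a, ha, hua, hva⟩

/-! ### Square roots of Pauli operators -/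

/-- The square root `(1 + ω²) / 2 + (1 - ω²) / 2 • P` of an involution `P`. -/
def sqrtMat (ω : EighthRoot) (P : Matrix (Basis n) (Basis n) ℂ) : Matrix (Basis n) (Basis n) ℂ :=
  ((1 + (ω : ℂ) ^ 2) / 2) • 1 + ((1 - (ω : ℂ) ^ 2) / 2) • P

theorem sqrtMat_mul_self {P : Matrix (Basis n) (Basis n) ℂ} (hP : P * P = 1) :
    sqrtMat ω P * sqrtMat ω P = P := by
  have hι := ω.sq_sq
  simp only [sqrtMat, add_mul, mul_add, smul_mul_smul_comm, mul_one, one_mul, hP]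
  match_scalars
  · linear_combination (1 / 2 : ℂ) * hι
  · linear_combination (-1 / 2 : ℂ) * hι

/-- Passing from `P` to `-P` exchanges the eigenvalues `1` and `ω²` of the root, so it inverts the
root up to a phase. Signs of Paulis therefore do not affect membership of roots in a subgroup
containing the phases. -/
theorem sqrtMat_mul_neg {P : Matrix (Basis n) (Basis n) ℂ} (hP : P * P = 1) :
    sqrtMat ω P * sqrtMat ω (-P) = ((ω : ℂ) ^ 2) • 1 := by
  simp only [sqrtMat, add_mul, mul_add, smul_mul_smul_comm, mul_one, one_mul, mul_neg, hP]
  match_scalars <;> ring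

theorem sqrtMat_anticomm {P Q : Matrix (Basis n) (Basis n) ℂ} (hP : P * P = 1)
    (hPQ : P * Q = -(Q * P)) : sqrtMat ω P * Q = (-(ω : ℂ) ^ 2) • (P * Q * sqrtMat ω P) := by
  have hι := ω.sq_sq
  have h1 : P * Q * P = -Q := by rw [hPQ, neg_mul, mul_assoc, hP, mul_one]
  simp only [sqrtMat, add_mul, mul_add, smul_mul_assoc, mul_one, one_mul, mul_smul_comm, h1]
  match_scalars <;> linear_combination (1 / 2 : ℂ) * hι

theorem W_mul_self_val (v : Label n) : (W ω v).1 * (W ω v).1 = 1 :=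
  congrArg Subtype.val (W_mul_self v)

theorem star_W (v : Label n) : star (W ω v).1 = (W ω v).1 := by
  rw [← Matrix.UnitaryGroup.inv_val, W_inv]

/-- The square root of a hermitian Pauli operator, as a unitary. -/
def R (ω : EighthRoot) {n : ℕ} (v : Label n) : U n :=
  ⟨sqrtMat ω (W ω v).1, by
    have hι := ω.sq_sq
    have hs := ω.star_sq
    have hc : (starRingEnd ℂ) ((ω : ℂ) ^ 2) = -(ω : ℂ) ^ 2 := hs
    rw [Matrix.mem_unitaryGroup_iff, sqrtMat, star_add, star_smul, star_smul, star_one, star_W]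
    simp only [add_mul, mul_add, smul_mul_smul_comm, mul_one, one_mul, W_mul_self_val,
      RCLike.star_def, map_div₀, map_add, map_sub, hc, map_one, map_ofNat]
    match_scalars
    · linear_combination (-1 / 2 : ℂ) * hι
    · linear_combination (1 / 2 : ℂ) * hι⟩

theorem coe_R (v : Label n) : (R ω v).1 = sqrtMat ω (W ω v).1 := rfl

theorem R_mul_self (v : Label n) : R ω v * R ω v = W ω v :=
  Subtype.ext (sqrtMat_mul_self (W_mul_self_val v))

theorem gateScalar_mem_phases (ω : EighthRoot) (n : ℕ) : gateScalar ω n ∈ phases n :=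
  ⟨(ω : ℂ) ^ 2, rfl⟩

theorem phases_comm {A : U n} (hA : A ∈ phases n) (B : U n) : A * B = B * A := by
  obtain ⟨a, ha⟩ := hA
  apply Subtype.ext
  rw [Submonoid.coe_mul, Submonoid.coe_mul, ha]
  simp

/-! ### The action on Pauli operators -/

/-- Conjugation by `A` maps the Pauli operator of label `v` to the one of label `w`, up to sign. -/
def Moves (ω : EighthRoot) {n : ℕ} (A : U n) (v w : Label n) : Prop :=
  A * W ω v * A⁻¹ = W ω w ∨ A * W ω v * A⁻¹ = -W ω w

/-- A conjugate of an involution is an involution, so the scalar squares to `1`. -/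
theorem moves_of_smul {A : U n} {v w : Label n} {c : ℂ}
    (hc : (A * W ω v).1 = c • (W ω w * A).1) : Moves ω A v w := by
  have h1 : (A * W ω v * A⁻¹).1 = c • (W ω w).1 := by
    rw [Submonoid.coe_mul, hc, smul_mul_assoc, ← Submonoid.coe_mul, mul_inv_cancel_right]
  have h2 : (A * W ω v * A⁻¹) * (A * W ω v * A⁻¹) = 1 := by
    rw [conj_mul, W_mul_self, mul_one, mul_inv_cancel]
  have h3 := congrArg Subtype.val h2
  rw [Submonoid.coe_mul, h1, smul_mul_smul_comm, W_mul_self_val] at h3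
  have h4 := congrFun (congrFun h3 0) 0
  simp only [Matrix.smul_apply, Matrix.one_apply_eq, OneMemClass.coe_one, smul_eq_mul,
    mul_one] at h4
  rcases mul_self_eq_one_iff.mp h4 with rfl | rfl
  · exact Or.inl (Subtype.ext (by rw [h1, one_smul]))
  · exact Or.inr (Subtype.ext (by rw [h1, neg_smul, one_smul, Unitary.coe_neg]))

theorem Moves.exists_smul {A : U n} {v w : Label n} (hA : Moves ω A v w) :
    ∃ c : ℂ, c ≠ 0 ∧ (A * W ω v * A⁻¹).1 = c • (W ω w).1 := by
  rcases hA with h1 | h1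
  · exact ⟨1, one_ne_zero, by rw [h1, one_smul]⟩
  · exact ⟨-1, neg_ne_zero.mpr one_ne_zero, by rw [h1, Unitary.coe_neg, neg_smul, one_smul]⟩

theorem moves_of_conj_smul {A : U n} {v w : Label n} {c : ℂ}
    (hc : (A * W ω v * A⁻¹).1 = c • (W ω w).1) : Moves ω A v w := by
  refine moves_of_smul (c := c) ?_
  calc (A * W ω v).1 = (A * W ω v * A⁻¹).1 * A.1 := by
        rw [← Submonoid.coe_mul, inv_mul_cancel_right]
    _ = c • (W ω w * A).1 := by rw [hc, smul_mul_assoc, Submonoid.coe_mul]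

theorem moves_of_commute {A : U n} {v : Label n} (hA : A * W ω v = W ω v * A) : Moves ω A v v :=
  Or.inl (by rw [hA, mul_inv_cancel_right])

theorem Moves.mul {A B : U n} {u v w : Label n} (hA : Moves ω A u v) (hB : Moves ω B v w) :
    Moves ω (B * A) u w := by
  have e : B * A * W ω u * (B * A)⁻¹ = B * (A * W ω u * A⁻¹) * B⁻¹ := by
    simp only [mul_inv_rev, mul_assoc]
  rw [Moves, e]
  rcases hA with h1 | h1 <;> rcases hB with h2 | h2 <;> simp [h1, h2]

theorem Moves.inv {A : U n} {v w : Label n} (hA : Moves ω A v w) : Moves ω A⁻¹ w v := by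
  rw [Moves, inv_inv]
  rcases hA with h1 | h1
  · left
    rw [← h1]; group
  · right
    rw [← neg_neg (W ω w), ← h1, mul_neg, neg_mul]
    congr 1
    group

theorem Moves.add {A : U n} {v w v' w' : Label n} (hv : Moves ω A v v') (hw : Moves ω A w w') :
    Moves ω A (v + w) (v' + w') := by
  obtain ⟨c, hc, h1⟩ := W_mul (ω := ω) v w
  obtain ⟨d, hd, h2⟩ := W_mul (ω := ω) v' w'
  obtain ⟨a, ha, h3⟩ := hv.exists_smul
  obtain ⟨b, hb, h4⟩ := hw.exists_smul
  refine moves_of_conj_smul (c := c⁻¹ * (a * b * d)) ?_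
  have h5 : (W ω (v + w)).1 = c⁻¹ • (W ω v * W ω w : U n).1 := by
    rw [Submonoid.coe_mul, h1, smul_smul, inv_mul_cancel₀ hc, one_smul]
  have h6 : A * (W ω v * W ω w) * A⁻¹ = (A * W ω v * A⁻¹) * (A * W ω w * A⁻¹) := by group
  rw [Submonoid.coe_mul, Submonoid.coe_mul, h5, mul_smul_comm, smul_mul_assoc, ← Submonoid.coe_mul,
    ← Submonoid.coe_mul, h6, Submonoid.coe_mul, h3, h4, smul_mul_smul_comm, h2, smul_smul,
    smul_smul, mul_assoc]

theorem neg_ne_self_unitary (A : U n) : -A ≠ A := by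
  intro h0
  have h1 : (-1 : U n) = 1 := by
    have := congrArg (· * A⁻¹) h0
    simpa using this
  have h2 := congrFun (congrFun (congrArg Subtype.val h1) 0) 0
  rw [Unitary.coe_neg] at h2
  norm_num at h2

/-- Conjugation preserves whether two operators commute, and the symplectic form records exactly
that. -/
theorem Moves.sp_eq {A : U n} {v w v' w' : Label n} (hv : Moves ω A v v') (hw : Moves ω A w w') :
    sp v' w' = sp v w := by
  have key : W ω v' * W ω w' = W ω w' * W ω v' ↔ W ω v * W ω w = W ω w * W ω v := by
    have h6 : A * (W ω v * W ω w) * A⁻¹ = (A * W ω v * A⁻¹) * (A * W ω w * A⁻¹) := by group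
    have h7 : A * (W ω w * W ω v) * A⁻¹ = (A * W ω w * A⁻¹) * (A * W ω v * A⁻¹) := by group
    have h8 : W ω v * W ω w = W ω w * W ω v ↔
        A * (W ω v * W ω w) * A⁻¹ = A * (W ω w * W ω v) * A⁻¹ := by
      rw [mul_left_inj, mul_right_inj]
    rw [h8, h6, h7]
    rcases hv with h1 | h1 <;> rcases hw with h2 | h2 <;> simp [h1, h2]
  have h3 : ∀ a b : Label n, W ω a * W ω b = W ω b * W ω a ↔ sp a b = 0 := by
    refine fun a b => ⟨fun hab => ?_, commute_W⟩
    rcases zmod_two_cases (sp a b) with h0 | h0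
    · exact h0
    · have h4 := anticommute_W (ω := ω) h0
      rw [hab] at h4
      exact absurd h4.symm (neg_ne_self_unitary _)
  rw [h3, h3] at key
  rcases zmod_two_cases (sp v w) with h0 | h0 <;>
    rcases zmod_two_cases (sp v' w') with h1 | h1 <;> simp [h0, h1] at key ⊢

theorem R_commute {v w : Label n} (hvw : sp v w = 0) : R ω v * W ω w = W ω w * R ω v := by
  have h1 : (W ω v).1 * (W ω w).1 = (W ω w).1 * (W ω v).1 := congrArg Subtype.val (commute_W hvw)
  apply Subtype.ext
  rw [Submonoid.coe_mul, Submonoid.coe_mul, coe_R, sqrtMat]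
  simp [add_mul, mul_add, h1]

/-- Together with `R_commute` this says that `R v` acts on labels as the symplectic transvection
along `v`. -/
theorem R_moves_of_sp_eq_one {v w : Label n} (hvw : sp v w = 1) : Moves ω (R ω v) w (v + w) := by
  obtain ⟨c, -, hc⟩ := W_mul (ω := ω) v w
  refine moves_of_smul (c := -(ω : ℂ) ^ 2 * c) ?_
  have h1 : (W ω v).1 * (W ω w).1 = -((W ω w).1 * (W ω v).1) :=
    congrArg Subtype.val (anticommute_W hvw)
  rw [Submonoid.coe_mul, coe_R, sqrtMat_anticomm (W_mul_self_val v) h1, hc, Submonoid.coe_mul,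
    coe_R, smul_mul_assoc, smul_smul]

/-- Conjugation commutes with forming `sqrtMat`; the second alternative is the effect of a sign, by
`sqrtMat_mul_neg`. -/
theorem conj_R (A : U n) {v w : Label n} (hA : Moves ω A v w) :
    A * R ω v * A⁻¹ = R ω w ∨ A * R ω v * A⁻¹ = (R ω w)⁻¹ * gateScalar ω n := by
  have h0 : (A * R ω v * A⁻¹).1 = sqrtMat ω (A * W ω v * A⁻¹).1 := by
    have hAA : A.1 * (A⁻¹).1 = 1 := congrArg Subtype.val (mul_inv_cancel A)
    simp only [Submonoid.coe_mul, coe_R, sqrtMat, mul_add, add_mul, mul_smul_comm, smul_mul_assoc,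
      mul_one, hAA]
  rcases hA with h1 | h1
  · exact Or.inl (Subtype.ext (by rw [h0, h1, coe_R]))
  · right
    rw [eq_inv_mul_iff_mul_eq]
    apply Subtype.ext
    rw [Submonoid.coe_mul, h0, h1, coe_R, Unitary.coe_neg, sqrtMat_mul_neg (W_mul_self_val w)]
    rfl

theorem conj_R_mem_iff {K : Subgroup (U n)} (hK : phases n ≤ K) {A : U n} {v w : Label n}
    (hA : Moves ω A v w) : A * R ω v * A⁻¹ ∈ K ↔ R ω w ∈ K := by
  rcases conj_R A hA with h1 | h1
  · rw [h1]
  · rw [h1, Subgroup.mul_mem_cancel_right _ (hK (gateScalar_mem_phases ω n)), inv_mem_iff]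

theorem R_mem_of_moves {K : Subgroup (U n)} (hK : phases n ≤ K) {A : U n} {v w : Label n}
    (hAK : A ∈ K) (hA : Moves ω A v w) (hv : R ω v ∈ K) : R ω w ∈ K :=
  (conj_R_mem_iff hK hA).mp (mul_mem (mul_mem hAK hv) (inv_mem hAK))

/-- Conjugating `R w` by the transvection `R v` gives `R (v + w)` up to inversion and phase. This is
the closure rule behind all the generation arguments. -/
theorem R_add_mem {K : Subgroup (U n)} (hK : phases n ≤ K) {v w : Label n}
    (hv : R ω v ∈ K) (hw : R ω w ∈ K) (hvw : sp v w = 1) : R ω (v + w) ∈ K :=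
  R_mem_of_moves hK hv (R_moves_of_sp_eq_one hvw) hw

theorem W_mem_of_R_mem {K : Subgroup (U n)} {v : Label n} (hv : R ω v ∈ K) : W ω v ∈ K := by
  rw [← R_mul_self]
  exact mul_mem hv hv

/-! ### Clifford operators -/

theorem onQubit_sigma (i : Fin n) (a : ZMod 2 × ZMod 2) :
    onQubit i (sigma ω a) = (W ω (Pi.single i a)).1 := by
  rw [coe_W, onQubit]
  congr 1
  funext k
  by_cases hk : k = i
  · subst hk; simp
  · simp [hk, sigma_zero]

theorem gateX_eq (i : Fin n) : gateX i = W ω (Pi.single i (1, 0)) :=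
  Subtype.ext (by rw [← onQubit_sigma, sigma_x]; rfl)

theorem gateZ_eq (i : Fin n) : gateZ i = W ω (Pi.single i (0, 1)) :=
  Subtype.ext (by rw [← onQubit_sigma, sigma_z]; rfl)

/-- The fourth roots of unity are the powers of `ω²`, and `ω² I` belongs to the Pauli group. -/
theorem phase_one_mem_pauli {c : ℂ} {A B : U n} (hA : A ∈ Pauli ω n) (hc : c ^ 4 = 1)
    (hB : B.1 = c • A.1) : B ∈ Pauli ω n := by
  have hι := ω.sq_sq
  have h1 : (c * c - 1) * ((c - (ω : ℂ) ^ 2) * (c + (ω : ℂ) ^ 2)) = 0 := by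
    linear_combination hc - (c * c - 1) * hι
  have hJ := gateScalar_mem_pauli ω n
  have hJ1 : ∀ D : U n, (gateScalar ω n * D).1 = ((ω : ℂ) ^ 2) • D.1 := fun D => by
    rw [Submonoid.coe_mul]
    change (((ω : ℂ) ^ 2) • (1 : Matrix (Basis n) (Basis n) ℂ)) * D.1 = _
    rw [smul_mul_assoc, one_mul]
  rcases mul_eq_zero.mp h1 with h2 | h2
  · rcases mul_self_eq_one_iff.mp (sub_eq_zero.mp h2) with rfl | rfl
    · rwa [Subtype.ext (hB.trans (one_smul _ _))]
    · have : B = gateScalar ω n * (gateScalar ω n * A) := Subtype.ext (by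
        rw [hB, hJ1, hJ1, smul_smul, hι])
      rw [this]
      exact mul_mem hJ (mul_mem hJ hA)
  · rcases mul_eq_zero.mp h2 with h3 | h3
    · have : B = gateScalar ω n * A := Subtype.ext (by rw [hB, hJ1, sub_eq_zero.mp h3])
      rw [this]
      exact mul_mem hJ hA
    · have : B = gateScalar ω n * (gateScalar ω n * (gateScalar ω n * A)) := Subtype.ext (by
        rw [hB, hJ1, hJ1, hJ1, smul_smul, smul_smul, eq_neg_of_add_eq_zero_left h3]
        congr 1
        linear_combination (-(ω : ℂ) ^ 2) * hι)
      rw [this]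
      exact mul_mem hJ (mul_mem hJ (mul_mem hJ hA))

theorem W_single_mem_pauli (i : Fin n) (a : ZMod 2 × ZMod 2) :
    W ω (Pi.single i a) ∈ Pauli ω n := by
  rcases pair_cases a with rfl | rfl | rfl | rfl
  · rw [Prod.mk_zero_zero, Pi.single_zero, W_zero]
    exact one_mem _
  · rw [← gateX_eq]
    exact gateX_mem_pauli ω i
  · rw [← gateZ_eq]
    exact gateZ_mem_pauli ω i
  · have : W ω (Pi.single i (1, 1)) = gateScalar ω n * (gateX i * gateZ i) := Subtype.ext (by
      rw [← onQubit_sigma, sigma_y, onQubit_smul, ← onQubit_mul]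
      change _ = (((ω : ℂ) ^ 2) • (1 : Matrix (Basis n) (Basis n) ℂ)) * _
      rw [smul_mul_assoc, one_mul]
      rfl)
    rw [this]
    exact mul_mem (gateScalar_mem_pauli ω n)
      (mul_mem (gateX_mem_pauli ω i) (gateZ_mem_pauli ω i))

theorem W_mem_pauli (v : Label n) : W ω v ∈ Pauli ω n := by
  have key : ∀ t : Finset (Fin n), W ω (∑ i ∈ t, Pi.single i (v i)) ∈ Pauli ω n := by
    intro t
    induction t using Finset.induction_on with
    | empty => rw [Finset.sum_empty, W_zero]; exact one_mem _
    | insert i t hi ih =>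
      rw [Finset.sum_insert hi, ← W_mul_of_disjoint]
      · exact mul_mem (W_single_mem_pauli i _) ih
      · intro k
        by_cases hk : k = i
        · subst hk
          right
          rw [Finset.sum_apply]
          refine Finset.sum_eq_zero fun j hj => Pi.single_eq_of_ne ?_ _
          rintro rfl
          exact hi hj
        · exact Or.inl (Pi.single_eq_of_ne hk _)
  have h1 := key Finset.univ
  rwa [Finset.univ_sum_single] at h1

theorem pauli_eq_smul_W {P : U n} (hP : P ∈ Pauli ω n) :
    ∃ (c : ℂ) (v : Label n), c ≠ 0 ∧ P.1 = c • (W ω v).1 := by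
  induction hP using Subgroup.closure_induction with
  | mem P hP =>
    rcases hP with (⟨i, rfl⟩ | ⟨i, rfl⟩) | rfl
    · exact ⟨1, _, one_ne_zero, by rw [one_smul, gateX_eq]⟩
    · exact ⟨1, _, one_ne_zero, by rw [one_smul, gateZ_eq]⟩
    · exact ⟨(ω : ℂ) ^ 2, 0, fun h0 => by simpa [h0] using ω.sq_sq, by rw [W_zero]; rfl⟩
  | one => exact ⟨1, 0, one_ne_zero, by rw [one_smul, W_zero]⟩
  | mul P Q _ _ hP hQ =>
    obtain ⟨c, v, hc, h1⟩ := hP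
    obtain ⟨d, w, hd, h2⟩ := hQ
    obtain ⟨e, he, h3⟩ := W_mul (ω := ω) v w
    exact ⟨c * d * e, v + w, mul_ne_zero (mul_ne_zero hc hd) he, by
      rw [Submonoid.coe_mul, h1, h2, smul_mul_smul_comm, h3, smul_smul]⟩
  | inv P _ hP =>
    obtain ⟨c, v, hc, h1⟩ := hP
    exact ⟨star c, v, star_ne_zero.mpr hc, by
      rw [Matrix.UnitaryGroup.inv_val, h1, star_smul, star_W]⟩

theorem exists_moves {A : U n} (hA : A ∈ Clifford ω n) (v : Label n) : ∃ w, Moves ω A v w := by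
  obtain ⟨c, w, -, hw⟩ := pauli_eq_smul_W
    ((Subgroup.mem_normalizer_iff.mp hA (W ω v)).mp (W_mem_pauli v))
  exact ⟨w, moves_of_conj_smul hw⟩

theorem mem_clifford_of_moves {A : U n} (h4 : A ^ 4 = 1) (hA : ∀ v, ∃ w, Moves ω A v w) :
    A ∈ Clifford ω n := by
  have key : ∀ v, ∃ P ∈ Pauli ω n, A * W ω v = P * A := by
    intro v
    obtain ⟨w, hw⟩ := hA v
    refine ⟨A * W ω v * A⁻¹, ?_, by rw [inv_mul_cancel_right]⟩
    rcases hw with h1 | h1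
    · rw [h1]
      exact W_mem_pauli w
    · rw [h1]
      refine phase_one_mem_pauli (c := -1) (W_mem_pauli w) (by norm_num) ?_
      rw [neg_smul, one_smul, Unitary.coe_neg]
  refine mem_clifford_of_gen ω A h4 (fun i => ?_) (fun i => ?_)
  · rw [gateX_eq (ω := ω)]
    exact key _
  · rw [gateZ_eq (ω := ω)]
    exact key _

theorem R_exists_moves (v w : Label n) : ∃ u, Moves ω (R ω v) w u := by
  rcases zmod_two_cases (sp v w) with h0 | h0
  · exact ⟨w, moves_of_commute (R_commute h0)⟩
  · exact ⟨v + w, R_moves_of_sp_eq_one h0⟩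

theorem R_mem_clifford (v : Label n) : R ω v ∈ Clifford ω n :=
  mem_clifford_of_moves
    (by rw [show (4 : ℕ) = 2 * 2 from rfl, pow_mul, pow_two (R ω v), R_mul_self, pow_two,
      W_mul_self]) (R_exists_moves v)

theorem phases_le_clifford : phases n ≤ Clifford ω n := by
  intro A hA
  rw [Clifford, Subgroup.mem_normalizer_iff]
  intro P
  rw [phases_comm hA, mul_inv_cancel_right]

theorem label_add_add_self (v w : Label n) : v + w + v = w := by
  rw [add_comm v, add_assoc, label_add_self, add_zero]

/-! ### Operators commuting with Pauli operators -/

/-- The label of `X` on qubit `i`. -/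
abbrev lx (i : Fin n) : Label n := Pi.single i (1, 0)

/-- The label of `Z` on qubit `i`. -/
abbrev lz (i : Fin n) : Label n := Pi.single i (0, 1)

/-- The operator `A` commutes with the Pauli operator of label `v`. -/
def Fixes (ω : EighthRoot) {n : ℕ} (A : U n) (v : Label n) : Prop := A * W ω v = W ω v * A

/-- The operator `A` commutes with the Pauli operators on the first `k` qubits. -/
def FixesBelow (ω : EighthRoot) {n : ℕ} (k : ℕ) (A : U n) : Prop :=
  ∀ i : Fin n, (i : ℕ) < k → Fixes ω A (lx i) ∧ Fixes ω A (lz i)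

theorem Fixes.mul {A B : U n} {v : Label n} (hA : Fixes ω A v) (hB : Fixes ω B v) :
    Fixes ω (A * B) v := by
  rw [Fixes] at hA hB ⊢
  rw [mul_assoc, hB, ← mul_assoc, hA, mul_assoc]

theorem FixesBelow.mul {k : ℕ} {A B : U n} (hA : FixesBelow ω k A) (hB : FixesBelow ω k B) :
    FixesBelow ω k (A * B) :=
  fun i hi => ⟨(hA i hi).1.mul (hB i hi).1, (hA i hi).2.mul (hB i hi).2⟩

theorem fixesBelow_R {k : ℕ} {v : Label n} (hv : SuppGE k v) : FixesBelow ω k (R ω v) := by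
  intro i hi
  constructor <;> refine R_commute ?_ <;> rw [sp_single, hv i hi] <;> simp [localForm]

theorem fixesBelow_W {k : ℕ} {v : Label n} (hv : SuppGE k v) : FixesBelow ω k (W ω v) := by
  rw [← R_mul_self]
  exact (fixesBelow_R hv).mul (fixesBelow_R hv)

theorem onQubit_matX_apply (i : Fin n) (x y : Basis n) :
    onQubit i matX x y = if y = Function.update x i (x i + 1) then 1 else 0 := by
  have key : ∀ a b : Fin 2, matX a b = if b = a + 1 then 1 else 0 := by
    intro a b
    fin_cases a <;> fin_cases b <;> simp [matX]
  rw [onQubit_apply, key]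
  by_cases hxy : ∀ k, k ≠ i → x k = y k
  · rw [if_pos hxy]
    refine if_congr ⟨fun hy => ?_, fun hy => by rw [hy]; simp⟩ rfl rfl
    funext k
    by_cases hk : k = i
    · subst hk; simpa using hy
    · simp [hk, hxy k hk]
  · rw [if_neg hxy, if_neg]
    rintro rfl
    exact hxy fun k hk => by simp [hk]

theorem eq_const_of_flip {f : Basis n → ℂ}
    (hf : ∀ x i, f (Function.update x i (x i + 1)) = f x) (x : Basis n) : f x = f 0 := by
  have h1 : ∀ (x : Basis n) i a, f (Function.update x i a) = f x := by
    intro x i a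
    have : ∀ a b : Fin 2, a = b ∨ a = b + 1 := by decide
    rcases this a (x i) with h0 | h0
    · rw [h0, Function.update_eq_self]
    · rw [h0, hf]
  have h2 : ∀ t : Finset (Fin n), f (fun k => if k ∈ t then x k else 0) = f 0 := by
    intro t
    induction t using Finset.induction_on with
    | empty => simp; rfl
    | insert i t hi ih =>
      rw [← ih, ← h1 (fun k => if k ∈ t then x k else 0) i (x i)]
      congr 1
      funext k
      by_cases hk : k = i
      · subst hk; simp
      · simp [hk]
  simpa using h2 Finset.univ

/-- Schur's lemma for the Pauli group by hand: commuting with every `Z` forces a diagonal matrix,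
and commuting with every `X`, which flips a bit, makes the diagonal constant. -/
theorem mem_phases_of_fixesBelow {A : U n} (hA : FixesBelow ω n A) : A ∈ phases n := by
  have hdiag : ∀ x y, x ≠ y → A.1 x y = 0 := by
    intro x y hxy
    obtain ⟨i, hi⟩ := Function.ne_iff.mp hxy
    have h1 : A * gateZ i = gateZ i * A := by
      rw [gateZ_eq (ω := ω)]; exact (hA i i.2).2
    have h2 : A.1 * onQubit i matZ = onQubit i matZ * A.1 := congrArg Subtype.val h1
    rw [onQubit_matZ] at h2
    have h3 := congrFun (congrFun h2 x) y
    rw [Matrix.mul_diagonal, Matrix.diagonal_mul] at h3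
    have h4 : ∀ a b : Fin 2, a ≠ b → (a = 1 ∧ b ≠ 1) ∨ (a ≠ 1 ∧ b = 1) := by decide
    rcases h4 _ _ hi with ⟨ha, hb⟩ | ⟨ha, hb⟩
    · rw [if_pos ha, if_neg hb] at h3
      linear_combination (1 / 2 : ℂ) * h3
    · rw [if_neg ha, if_pos hb] at h3
      linear_combination (-1 / 2 : ℂ) * h3
  have hflip : ∀ x i, A.1 (Function.update x i (x i + 1)) (Function.update x i (x i + 1)) =
      A.1 x x := by
    intro x i
    have h1 : A * gateX i = gateX i * A := by
      rw [gateX_eq (ω := ω)]; exact (hA i i.2).1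
    have h2 : A.1 * onQubit i matX = onQubit i matX * A.1 := congrArg Subtype.val h1
    have h3 := congrFun (congrFun h2 x) (Function.update x i (x i + 1))
    rw [Matrix.mul_apply, Matrix.mul_apply, Finset.sum_eq_single x, Finset.sum_eq_single
      (Function.update x i (x i + 1))] at h3
    · simpa [onQubit_matX_apply] using h3.symm
    · intro y _ hy
      rw [onQubit_matX_apply, if_neg hy, zero_mul]
    · simp
    · intro y _ hy
      rw [hdiag x y hy.symm, zero_mul]
    · simp
  refine ⟨A.1 0 0, ?_⟩
  ext x y
  by_cases hxy : x = y
  · subst hxy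
    simpa using eq_const_of_flip (f := fun x => A.1 x x) hflip x
  · simp [hdiag x y hxy, hxy]

/-- Being trivial on a qubit means being orthogonal to its `X` and `Z`, and the action preserves the
form. -/
theorem Moves.suppGE {k : ℕ} {A : U n} (hA : FixesBelow ω k A) {v w : Label n} (hv : SuppGE k v)
    (hvw : Moves ω A v w) : SuppGE k w := by
  intro i hi
  have h1 := hvw.sp_eq (moves_of_commute (hA i hi).1)
  have h2 := hvw.sp_eq (moves_of_commute (hA i hi).2)
  rw [sp_single, sp_single, hv i hi] at h1 h2
  have : ∀ a : ZMod 2 × ZMod 2, localForm a (1, 0) = localForm 0 (1, 0) →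
      localForm a (0, 1) = localForm 0 (0, 1) → a = 0 := by decide
  exact this _ h1 h2

/-- A wrong sign is repaired by a Pauli anticommuting with `W u`. -/
theorem fixes_or_of_moves {A : U n} {u v : Label n} (hA : Moves ω A u u) (huv : sp v u = 1) :
    Fixes ω A u ∨ Fixes ω (W ω v * A) u := by
  rcases hA with h1 | h1
  · left
    rw [Fixes, ← mul_inv_eq_iff_eq_mul, h1]
  · right
    have h2 : A * W ω u = -(W ω u * A) := by rw [← neg_mul, ← mul_inv_eq_iff_eq_mul, h1]
    rw [Fixes, mul_assoc, h2, mul_neg, ← mul_assoc, anticommute_W huv, neg_mul, neg_neg, mul_assoc]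

/-- A scalar Pauli is central, whereas a nonzero label anticommutes with some other one. -/
theorem Moves.ne_zero {A : U n} {v w : Label n} (hA : Moves ω A v w) (hv : v ≠ 0) : w ≠ 0 := by
  rintro rfl
  refine hv ?_
  have h1 : W ω v = 1 ∨ W ω v = -1 := by
    rcases hA with h1 | h1
    · left
      rwa [W_zero, mul_inv_eq_one, mul_eq_left] at h1
    · right
      rw [W_zero, mul_inv_eq_iff_eq_mul, neg_mul, one_mul] at h1
      rw [← mul_right_inj A, h1, mul_neg, mul_one]
  by_contra hne
  obtain ⟨w, -, hw⟩ := exists_sp_eq_one (suppGE_zero v) hne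
  have h2 := anticommute_W (ω := ω) hw
  rcases h1 with h1 | h1 <;> rw [h1] at h2 <;> simp only [one_mul, mul_one, neg_mul, mul_neg] at h2
  · exact neg_ne_self_unitary _ h2.symm
  · exact neg_ne_self_unitary (-W ω w) h2.symm

/-! ### Generation of stabilizers -/

theorem sp_lx_lz (i : Fin n) : sp (lx i) (lz i) = 1 := by
  rw [sp_single]; simp [localForm]

theorem lx_ne_zero (i : Fin n) : lx i ≠ 0 := by
  rw [Ne, Pi.single_eq_zero_iff]; decide

theorem lz_ne_zero (i : Fin n) : lz i ≠ 0 := by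
  rw [Ne, Pi.single_eq_zero_iff]; decide

/-- An operator commuting with the Pauli operators on the qubits before `k` and with `Z` on
qubit `k` can be corrected so as to commute also with `X` on qubit `k`. -/
theorem exists_fix_lx {K : Subgroup (U n)} (k : Fin n)
    (hR : ∀ v : Label n, v ≠ 0 → SuppGE k v → sp v (lz k) = 0 → R ω v ∈ K)
    {A : U n} (hAC : A ∈ Clifford ω n) (hA : FixesBelow ω k A) (hAz : Fixes ω A (lz k)) :
    ∃ B ∈ K, FixesBelow ω (k + 1) (B * A) := by
  obtain ⟨q, hq⟩ := exists_moves hAC (lx k)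
  have hxs : SuppGE k (lx k) := suppGE_single le_rfl _
  have hzs : SuppGE k (lz k) := suppGE_single le_rfl _
  have hqs : SuppGE k q := hq.suppGE hA hxs
  have hqz : sp q (lz k) = 1 := by
    rw [hq.sp_eq (moves_of_commute hAz), sp_lx_lz]
  have hzz : sp (lz k) (lz k) = 0 := sp_self _
  have hxz := sp_lx_lz k
  have hRz : R ω (lz k) ∈ K := hR _ (lz_ne_zero k) hzs (sp_self _)
  have hRzf : Fixes ω (R ω (lz k)) (lz k) := R_commute (sp_self _)
  have h11 : (1 + 1 : ZMod 2) = 0 := by decide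
  -- move `q` to `lx k`
  have key : ∀ q : Label n, SuppGE k q → sp q (lz k) = 1 → sp q (lx k) = 1 →
      ∃ B ∈ K, FixesBelow ω k B ∧ Fixes ω B (lz k) ∧ Moves ω B q (lx k) := by
    intro q hqs hqz hqx
    have h1 : sp (q + lx k) (lz k) = 0 := by rw [sp_add_left, hqz, hxz, h11]
    have h2 : SuppGE k (q + lx k) := hqs.add hxs
    refine ⟨R ω (q + lx k), hR _ (add_ne_zero_of_sp hqx) h2 h1, fixesBelow_R h2, R_commute h1, ?_⟩
    have h3 : sp (q + lx k) q = 1 := by rw [sp_add_left, sp_self, sp_comm, hqx, zero_add]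
    have h4 := R_moves_of_sp_eq_one (ω := ω) h3
    rwa [label_add_add_self] at h4
  have hB : ∃ B ∈ K, FixesBelow ω k B ∧ Fixes ω B (lz k) ∧ Moves ω B q (lx k) := by
    rcases zmod_two_cases (sp q (lx k)) with h0 | h0
    -- If `q` commutes with `X`, the transvection along `lz k` first replaces it by `lz k + q`,
    -- which anticommutes with `X`.
    · have hz1 : sp (lz k) q = 1 := by rw [sp_comm, hqz]
      obtain ⟨B, hBK, hB1, hB2, hB3⟩ := key (lz k + q) (hzs.add hqs)
        (by rw [sp_add_left, hzz, hqz, zero_add])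
        (by rw [sp_add_left, h0, sp_comm, hxz, add_zero])
      exact ⟨B * R ω (lz k), mul_mem hBK hRz, hB1.mul (fixesBelow_R hzs), hB2.mul hRzf,
        (R_moves_of_sp_eq_one hz1).mul hB3⟩
    · exact key q hqs hqz h0
  obtain ⟨B, hBK, hB1, hB2, hB3⟩ := hB
  have hfin : ∀ D ∈ K, FixesBelow ω k D → Fixes ω D (lz k) → Fixes ω (D * A) (lx k) →
      ∃ B ∈ K, FixesBelow ω (k + 1) (B * A) := by
    intro D hD h1 h2 h3
    refine ⟨D, hD, fun i hi => ?_⟩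
    rcases Nat.lt_succ_iff_lt_or_eq.mp hi with h4 | h4
    · exact (h1.mul hA) i h4
    · have : i = k := Fin.ext h4
      subst this
      exact ⟨h3, h2.mul hAz⟩
  -- The label of the image of `X` is now right. A remaining sign is removed by `Z` on qubit `k`,
  -- which keeps everything already fixed.
  rcases fixes_or_of_moves (v := lz k) (hq.mul hB3) (by rw [sp_comm, hxz]) with h5 | h5
  · exact hfin B hBK hB1 hB2 h5
  · rw [← mul_assoc] at h5
    refine hfin _ (mul_mem (W_mem_of_R_mem hRz) hBK) ((fixesBelow_W hzs).mul hB1)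
      (Fixes.mul ?_ hB2) h5
    exact commute_W (sp_self _)

/-- An operator commuting with the Pauli operators on the qubits before `k` can be corrected so
as to commute also with `Z` on qubit `k`. -/
theorem exists_fix_lz {K : Subgroup (U n)} (k : Fin n)
    (hR : ∀ v : Label n, v ≠ 0 → SuppGE k v → R ω v ∈ K)
    {A : U n} (hAC : A ∈ Clifford ω n) (hA : FixesBelow ω k A) :
    ∃ B ∈ K, FixesBelow ω k (B * A) ∧ Fixes ω (B * A) (lz k) := by
  obtain ⟨q, hq⟩ := exists_moves hAC (lz k)
  have hxs : SuppGE k (lx k) := suppGE_single le_rfl _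
  have hzs : SuppGE k (lz k) := suppGE_single le_rfl _
  have hqs : SuppGE k q := hq.suppGE hA hzs
  have hq0 : q ≠ 0 := hq.ne_zero (lz_ne_zero k)
  have key : ∀ u v : Label n, SuppGE k u → SuppGE k v → sp u v = 1 →
      ∃ B ∈ K, FixesBelow ω k B ∧ Moves ω B u v := by
    intro u v hu hv huv
    refine ⟨R ω (u + v), hR _ (add_ne_zero_of_sp huv) (hu.add hv), fixesBelow_R (hu.add hv), ?_⟩
    have h3 : sp (u + v) u = 1 := by rw [sp_add_left, sp_self, sp_comm, huv, zero_add]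
    have h4 := R_moves_of_sp_eq_one (ω := ω) h3
    rwa [label_add_add_self] at h4
  -- Two transvections lead from `q` to `lz k` through a label `w` anticommuting with both, whatever
  -- the value of `sp q (lz k)`.
  obtain ⟨w, hws, hqw, hzw⟩ := exists_sp_eq_one_pair hqs hq0 hzs (lz_ne_zero k)
  obtain ⟨B, hBK, hB1, hB2⟩ := key q w hqs hws hqw
  obtain ⟨D, hDK, hD1, hD2⟩ := key w (lz k) hws hzs (by rw [sp_comm, hzw])
  rcases fixes_or_of_moves (v := lx k) ((hq.mul hB2).mul hD2) (sp_lx_lz k) with h5 | h5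
  · rw [← mul_assoc] at h5
    exact ⟨D * B, mul_mem hDK hBK, (hD1.mul hB1).mul hA, h5⟩
  · rw [← mul_assoc, ← mul_assoc] at h5
    exact ⟨W ω (lx k) * D * B, mul_mem (mul_mem (W_mem_of_R_mem (hR _ (lx_ne_zero k) hxs)) hDK) hBK,
      (((fixesBelow_W hxs).mul hD1).mul hB1).mul hA, h5⟩

/-- Each step corrects the operator on one more qubit by elements of `K`, with `d` counting the
qubits left. Once no qubit is left the operator is a phase. -/
theorem mem_of_fixesBelow {K : Subgroup (U n)} (hK : phases n ≤ K) (hKC : K ≤ Clifford ω n)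
    (d : ℕ) : ∀ k : ℕ, k + d = n → (∀ v : Label n, v ≠ 0 → SuppGE k v → R ω v ∈ K) →
    ∀ A ∈ Clifford ω n, FixesBelow ω k A → A ∈ K := by
  induction d with
  | zero =>
    intro k hk _ A _ hA
    rw [add_zero] at hk
    subst hk
    exact hK (mem_phases_of_fixesBelow hA)
  | succ d ih =>
    intro k hk hR A hAC hA
    obtain ⟨i, rfl⟩ : ∃ i : Fin n, (i : ℕ) = k := ⟨⟨k, by omega⟩, rfl⟩
    obtain ⟨B, hBK, hB1, hB2⟩ := exists_fix_lz i hR hAC hA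
    obtain ⟨D, hDK, hD⟩ := exists_fix_lx i (fun v h0 hv _ => hR v h0 hv)
      (mul_mem (hKC hBK) hAC) hB1 hB2
    have h1 := ih (i + 1) (by omega) (fun v h0 hv => hR v h0 (hv.mono (Nat.le_succ _)))
      (D * (B * A)) (mul_mem (hKC hDK) (mul_mem (hKC hBK) hAC)) hD
    rwa [Subgroup.mul_mem_cancel_left _ hDK, Subgroup.mul_mem_cancel_left _ hBK] at h1

/-- The Clifford operators commuting with `Z` on the first qubit are generated, up to phases, by
the square roots of the Pauli operators commuting with it. -/
theorem mem_of_fixes_lz [NeZero n] {K : Subgroup (U n)} (hK : phases n ≤ K)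
    (hKC : K ≤ Clifford ω n) (hR : ∀ v : Label n, v ≠ 0 → sp v (lz 0) = 0 → R ω v ∈ K) {A : U n}
    (hAC : A ∈ Clifford ω n) (hA : Fixes ω A (lz 0)) : A ∈ K := by
  obtain ⟨B, hBK, hB⟩ := exists_fix_lx 0 (fun v h0 _ hv => hR v h0 hv) hAC
    (fun i hi => absurd hi (by simp)) hA
  have hn : 0 < n := Nat.pos_of_ne_zero (NeZero.ne n)
  have h1 := mem_of_fixesBelow hK hKC (n - 1) 1 (by omega) (fun v h0 hv => hR v h0 (by
    rw [sp_single, hv 0 (by simp)]; simp [localForm])) (B * A) (mul_mem (hKC hBK) hAC) (by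
      simpa using hB)
  rwa [Subgroup.mul_mem_cancel_left _ hBK] at h1

/-! ### Generating all square roots of Pauli operators -/

theorem lx_self (i : Fin n) : lx i i = (1, 0) := Pi.single_eq_same _ _

theorem lz_self (i : Fin n) : lz i i = (0, 1) := Pi.single_eq_same _ _

theorem lz_of_ne {i j : Fin n} (hij : j ≠ i) : lz i j = 0 := Pi.single_eq_of_ne hij _

theorem R_zero : R ω (0 : Label n) = 1 := by
  apply Subtype.ext
  rw [coe_R, sqrtMat, W_zero]
  change ((1 + (ω : ℂ) ^ 2) / 2) • (1 : Matrix (Basis n) (Basis n) ℂ) + _ • 1 = 1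
  rw [← add_smul]
  convert one_smul ℂ (1 : Matrix (Basis n) (Basis n) ℂ) using 2
  ring

theorem R_single_mem {K : Subgroup (U n)} (hK : phases n ≤ K) {i : Fin n}
    (hx : R ω (lx i) ∈ K) (hz : R ω (lz i) ∈ K) (a : ZMod 2 × ZMod 2) :
    R ω (Pi.single i a) ∈ K := by
  rcases pair_cases a with rfl | rfl | rfl | rfl
  · rw [Prod.mk_zero_zero, Pi.single_zero, R_zero]
    exact one_mem _
  · exact hx
  · exact hz
  · have h1 := R_add_mem hK hx hz (sp_lx_lz i)
    rwa [← Pi.single_add] at h1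

/-- Starting from `Z ⊗ Z`, each factor is changed separately: a nonzero `a ≠ Z` anticommutes with
`Z`, so adding `Z + a` on that site is an instance of `R_add_mem`. -/
theorem R_pair_mem {K : Subgroup (U n)} (hK : phases n ≤ K) {i j : Fin n} (hij : i ≠ j)
    (hi : ∀ a, R ω (Pi.single i a) ∈ K) (hj : ∀ a, R ω (Pi.single j a) ∈ K)
    (hzz : R ω (lz i + lz j) ∈ K) (a b : ZMod 2 × ZMod 2) :
    R ω (Pi.single i a + Pi.single j b) ∈ K := by
  by_cases ha : a = 0
  · rw [ha, Pi.single_zero, zero_add]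
    exact hj b
  by_cases hb : b = 0
  · rw [hb, Pi.single_zero, add_zero]
    exact hi a
  have h1 : ∀ c d : ZMod 2 × ZMod 2, c ≠ 0 → c ≠ d → d ≠ 0 → localForm d (d + c) = 1 := by decide
  have h2 : ∀ c d : ZMod 2 × ZMod 2, c + (c + d) = d := by decide
  have h3 : R ω (Pi.single i a + lz j) ∈ K := by
    by_cases hz : a = (0, 1)
    · rwa [hz]
    · have h4 := R_add_mem hK hzz (hi ((0, 1) + a)) (by
        rw [sp_single, Pi.add_apply, lz_self, lz_of_ne hij, add_zero,
          h1 a _ ha hz (by decide)])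
      rwa [add_right_comm, ← Pi.single_add, h2] at h4
  by_cases hz : b = (0, 1)
  · rwa [hz]
  · have h4 := R_add_mem hK h3 (hj ((0, 1) + b)) (by
      rw [sp_single, Pi.add_apply, lz_self, Pi.single_eq_of_ne hij.symm, zero_add,
        h1 b _ hb hz (by decide)])
    rwa [add_assoc, ← Pi.single_add, h2] at h4

theorem update_add_single (v : Label n) (i : Fin n) :
    Function.update v i 0 + Pi.single i (v i) = v := by
  funext k
  by_cases hk : k = i
  · subst hk; simp
  · simp [hk]

/-- Induction on the length of the support. The entry on the last site `j` is attached through the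
neighbouring site `p`, where two-site labels are available by `R_pair_mem`; hence neighbouring `ZZ`
roots are enough. -/
theorem R_mem_of_suppGE {K : Subgroup (U n)} (hK : phases n ≤ K) (k : ℕ)
    (hs : ∀ i : Fin n, k ≤ i → ∀ a, R ω (Pi.single i a) ∈ K)
    (hzz : ∀ (i : Fin n) (hi : (i : ℕ) + 1 < n), k ≤ i → R ω (lz i + lz ⟨i + 1, hi⟩) ∈ K) :
    ∀ v : Label n, SuppGE k v → R ω v ∈ K := by
  have main : ∀ m : ℕ, ∀ v : Label n, SuppGE k v → (∀ i : Fin n, m ≤ i → v i = 0) →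
      R ω v ∈ K := by
    intro m
    induction m with
    | zero =>
      intro v _ hv
      have : v = 0 := funext fun i => hv i (Nat.zero_le _)
      rw [this, R_zero]
      exact one_mem _
    | succ m ih =>
      intro v hvk hvm
      by_cases hmn : n ≤ m
      · exact ih v hvk fun i hi => absurd (i.2.trans_le hmn) (not_lt.mpr hi)
      by_cases hmk : m < k
      · exact ih v hvk fun i hi => by
          rcases hi.eq_or_lt with h0 | h0
          · exact hvk i (h0 ▸ hmk)
          · exact hvm i h0
      obtain ⟨j, rfl⟩ : ∃ j : Fin n, (j : ℕ) = m := ⟨⟨m, by omega⟩, rfl⟩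
      have hkj : k ≤ j := not_lt.mp hmk
      rw [← update_add_single v j]
      set u := Function.update v j 0 with hu
      have huk : SuppGE k u := fun i hi => by
        by_cases hij : i = j
        · rw [hij, hu, Function.update_self]
        · rw [hu, Function.update_of_ne hij, hvk i hi]
      have hum : ∀ i : Fin n, (j : ℕ) ≤ i → u i = 0 := fun i hi => by
        by_cases hij : i = j
        · rw [hij, hu, Function.update_self]
        · rw [hu, Function.update_of_ne hij]
          exact hvm i (lt_of_le_of_ne hi fun h0 => hij (Fin.ext h0.symm))
      rcases hkj.eq_or_lt with hkj' | hkj'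
      · have : u = 0 := funext fun i => by
          rcases lt_or_ge (i : ℕ) k with h0 | h0
          · exact huk i h0
          · exact hum i (hkj' ▸ h0)
        rw [this, zero_add]
        exact hs j hkj _
      -- the site before `j`
      obtain ⟨p, hp⟩ : ∃ p : Fin n, (p : ℕ) + 1 = j := ⟨⟨j - 1, by omega⟩, by simp; omega⟩
      have hpj : p ≠ j := by rintro rfl; omega
      have hkp : k ≤ p := by omega
      have hpair : ∀ a b, R ω (Pi.single p a + Pi.single j b) ∈ K := by
        refine R_pair_mem hK hpj (hs p hkp) (hs j hkj) ?_
        have h1 := hzz p (hp ▸ j.2) hkp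
        have h2 : (⟨p + 1, hp ▸ j.2⟩ : Fin n) = j := Fin.ext hp
        rwa [h2] at h1
      have hpsupp : ∀ c, SuppGE k (Pi.single p c : Label n) := fun c => suppGE_single hkp c
      have hpm : ∀ c (i : Fin n), (j : ℕ) ≤ i → (Pi.single p c : Label n) i = 0 := fun c i hi =>
        Pi.single_eq_of_ne (by rintro rfl; omega) _
      have hex : ∀ b : ZMod 2 × ZMod 2, b ≠ 0 → ∃ c, localForm b c = 1 := by decide
      -- When `u p ≠ 0`, choose `c` anticommuting with `u p`. Then `u + c` at `p` and the two-site
      -- label `(c, a)` anticommute, and `c` cancels in their sum.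
      have case1 : ∀ u : Label n, SuppGE k u → (∀ i : Fin n, (j : ℕ) ≤ i → u i = 0) → u p ≠ 0 →
          ∀ a, R ω (u + Pi.single j a) ∈ K := by
        intro u huk hum hup a
        obtain ⟨c, hc⟩ := hex _ hup
        have h1 := R_add_mem hK (ih (u + Pi.single p c) (huk.add (hpsupp c)) fun i hi => by
          rw [Pi.add_apply, hum i hi, hpm c i hi, add_zero]) (hpair c a) (by
            rw [sp_add_right, sp_single, sp_single, Pi.add_apply, Pi.add_apply,
              Pi.single_eq_same, Pi.single_eq_of_ne hpj.symm, hum j le_rfl, localForm_add_left, hc,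
              localForm_self]
            simp [localForm])
        rwa [add_assoc, label_add_add] at h1
      by_cases hup : u p = 0
      · by_cases ha : v j = 0
        · rw [ha, Pi.single_zero, add_zero]
          exact ih u huk hum
        -- When `u p = 0`, an `X` is inserted at `p` to reach the previous case. It cancels against
        -- the `X` of the second summand, while `c` and `v j + c` anticommute at `j` and add up to
        -- `v j`.
        · obtain ⟨c, hc⟩ := hex _ ha
          have h1 := R_add_mem hK (case1 (u + lx p) (huk.add (hpsupp _)) (fun i hi => by
            rw [Pi.add_apply, hum i hi, zero_add]; exact hpm _ i hi) (by
              rw [Pi.add_apply, hup, lx_self]; decide) c) (hpair (1, 0) (v j + c)) (by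
              rw [sp_add_right, sp_single, sp_single]
              simp only [Pi.add_apply, Pi.single_eq_same, Pi.single_eq_of_ne hpj,
                Pi.single_eq_of_ne hpj.symm, hup, hum j le_rfl, zero_add, add_zero, localForm_self]
              rw [localForm_comm, localForm_add_left, hc, localForm_self, add_zero])
          have h2 : ∀ c d : ZMod 2 × ZMod 2, c + (d + c) = d := by decide
          have h3 : u + lx p + Pi.single j c + (Pi.single p (1, 0) + Pi.single j (v j + c)) =
              u + Pi.single j (v j) := by
            rw [add_add_add_comm, add_assoc u, label_add_self, add_zero, ← Pi.single_add, h2]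
          rwa [h3] at h1
      · exact case1 u huk hum hup _
  exact fun v hv => main n v hv fun i hi => absurd i.2 (not_lt.mpr hi)

theorem sp_lz_zero_of_suppGE [NeZero n] {v : Label n} (hv : SuppGE 1 v) : sp (lz 0) v = 0 := by
  rw [sp_single_left, hv 0 (by simp)]; simp [localForm]

/-- If `t` and `v` anticommute, adding `t + v`, whose root is available, turns `lz 0 + t` into `lz 0
+ v`. A common anticommuting label links arbitrary nonzero `t` and `v`. -/
theorem R_lz_add_mem [NeZero n] {K : Subgroup (U n)} (hK : phases n ≤ K)
    (htail : ∀ v : Label n, SuppGE 1 v → R ω v ∈ K) {t : Label n} (ht : SuppGE 1 t) (ht0 : t ≠ 0)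
    (htK : R ω (lz 0 + t) ∈ K) {v : Label n} (hv : SuppGE 1 v) (hv0 : v ≠ 0) :
    R ω (lz 0 + v) ∈ K := by
  have key : ∀ t v : Label n, SuppGE 1 t → SuppGE 1 v → sp t v = 1 → R ω (lz 0 + t) ∈ K →
      R ω (lz 0 + v) ∈ K := by
    intro t v ht hv htv htK
    have h1 := R_add_mem hK htK (htail _ (ht.add hv)) (by
      rw [sp_add_left, sp_lz_zero_of_suppGE (ht.add hv), sp_add_right, sp_self, htv, zero_add,
        zero_add])
    rwa [add_assoc, label_add_add] at h1
  obtain ⟨w, hw, htw, hvw⟩ := exists_sp_eq_one_pair ht ht0 hv hv0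
  exact key w v hw hv (by rw [sp_comm, hvw]) (key t w ht hw htw htK)

/-- A criterion for a subgroup to contain all Clifford operators commuting with `Z` on the first
qubit. -/
theorem mem_of_fixes_lz_of_generators [NeZero n] {K : Subgroup (U n)} (hK : phases n ≤ K)
    (hKC : K ≤ Clifford ω n) (hz : R ω (lz 0) ∈ K) (htail : ∀ v : Label n, SuppGE 1 v → R ω v ∈ K)
    (ht : 2 ≤ n → ∃ t : Label n, SuppGE 1 t ∧ t ≠ 0 ∧ R ω (lz 0 + t) ∈ K) {A : U n}
    (hAC : A ∈ Clifford ω n) (hA : Fixes ω A (lz 0)) : A ∈ K := by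
  refine mem_of_fixes_lz hK hKC (fun v _ hv => ?_) hAC hA
  have hu : SuppGE 1 (Function.update v 0 0) := fun i hi => by
    have : i = 0 := Fin.ext (by simpa using hi)
    rw [this, Function.update_self]
  -- A label orthogonal to `lz 0` is `0` or `Z` on the first qubit, so it has the form `u` or `u +
  -- lz 0` with `u` supported on the other qubits.
  have h1 : ∀ a : ZMod 2 × ZMod 2, localForm a (0, 1) = 0 → a = 0 ∨ a = (0, 1) := by decide
  rw [sp_single] at hv
  rw [← update_add_single v 0]
  rcases h1 _ hv with h2 | h2
  · rw [h2, Pi.single_zero, add_zero]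
    exact htail _ hu
  · rw [h2]
    by_cases hu0 : Function.update v 0 0 = 0
    · rw [hu0, zero_add]
      exact hz
    · have hn : 2 ≤ n := by
        by_contra hlt
        refine hu0 (funext fun i => hu i ?_)
        omega
      obtain ⟨t, ht1, ht0, htK⟩ := ht hn
      rw [add_comm]
      exact R_lz_add_mem hK htail ht1 ht0 htK hu hu0

/-! ### The gates as square roots of Pauli operators -/

theorem onQubit_add (i : Fin n) (A B : Matrix (Fin 2) (Fin 2) ℂ) :
    onQubit i (A + B) = onQubit i A + onQubit i B := by
  ext x y
  simp only [Matrix.add_apply, onQubit_apply]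
  split_ifs <;> simp

theorem coe_R_single (i : Fin n) (a : ZMod 2 × ZMod 2) :
    (R ω (Pi.single i a)).1 =
      onQubit i (((1 + (ω : ℂ) ^ 2) / 2) • 1 + ((1 - (ω : ℂ) ^ 2) / 2) • sigma ω a) := by
  rw [onQubit_add, onQubit_smul, onQubit_smul, onQubit_one, onQubit_sigma]
  rfl

theorem gateS_eq (i : Fin n) : gateS ω i = R ω (lz i) := by
  apply Subtype.ext
  rw [coe_R_single, sigma_z]
  change onQubit i (matS ω) = _
  congr 1
  ext a b
  fin_cases a <;> fin_cases b <;> simp [matS, matZ] <;> ring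

theorem gateH_mul_self (i : Fin n) : gateH i * gateH i = 1 := Subtype.ext (by
  change onQubit i matH * onQubit i matH = 1
  rw [onQubit_mul, matH_mul_self, onQubit_one])

theorem gateCZ_mul_self (i j : Fin n) : gateCZ i j * gateCZ i j = 1 :=
  Subtype.ext (matCZ_mul_self i j)

theorem gateH_mul_X (i : Fin n) : gateH i * W ω (lx i) = W ω (lz i) * gateH i := by
  rw [← gateX_eq, ← gateZ_eq]
  apply Subtype.ext
  change onQubit i matH * onQubit i matX = onQubit i matZ * onQubit i matH
  rw [onQubit_mul, onQubit_mul]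
  congr 1
  ext a b
  fin_cases a <;> fin_cases b <;> simp [matH, matX, matZ, Matrix.mul_apply, Fin.sum_univ_two]

theorem gateH_mul_Z (i : Fin n) : gateH i * W ω (lz i) = W ω (lx i) * gateH i := by
  have h1 := congrArg (fun A => gateH i * A * gateH i) (gateH_mul_X (ω := ω) i)
  simp only [← mul_assoc, gateH_mul_self, one_mul] at h1
  simp only [mul_assoc, gateH_mul_self, mul_one] at h1
  exact h1.symm

theorem gateH_moves_lz (i : Fin n) : Moves ω (gateH i) (lz i) (lx i) :=
  Or.inl (by rw [gateH_mul_Z, mul_inv_cancel_right])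

theorem gateH_fixes {i j : Fin n} (hij : i ≠ j) (a : ZMod 2 × ZMod 2) :
    Fixes ω (gateH i) (Pi.single j a) := by
  apply Subtype.ext
  change onQubit i matH * (W ω (Pi.single j a)).1 = (W ω (Pi.single j a)).1 * onQubit i matH
  rw [← onQubit_sigma, onQubit_comm hij]

theorem gateCZ_fixes_lz (i j k : Fin n) : Fixes ω (gateCZ i j) (lz k) := by
  rw [Fixes, ← gateZ_eq]
  apply Subtype.ext
  change matCZ i j * onQubit k matZ = onQubit k matZ * matCZ i j
  rw [onQubit_matZ, matCZ, Matrix.diagonal_mul_diagonal, Matrix.diagonal_mul_diagonal]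
  congr 1
  funext x
  exact mul_comm _ _

theorem gateCZ_moves_lx {i j : Fin n} (hij : i ≠ j) :
    Moves ω (gateCZ i j) (lx i) (lx i + lz j) := by
  left
  rw [mul_inv_eq_iff_eq_mul, ← W_mul_of_disjoint, ← gateX_eq, ← gateZ_eq]
  · exact Subtype.ext (matCZ_matX hij)
  · intro k
    by_cases hk : k = i
    · subst hk
      exact Or.inr (Pi.single_eq_of_ne hij _)
    · exact Or.inl (Pi.single_eq_of_ne hk _)

theorem coe_W_lz (i : Fin n) :
    (W ω (lz i)).1 = Matrix.diagonal fun x : Basis n => if x i = 1 then (-1 : ℂ) else 1 := by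
  rw [← gateZ_eq, ← onQubit_matZ]
  rfl

theorem coe_W_lz_add {i : Fin n} {v : Label n} (hv : v i = 0) {d : Basis n → ℂ}
    (hd : (W ω v).1 = Matrix.diagonal d) :
    (W ω (lz i + v)).1 = Matrix.diagonal fun x => (if x i = 1 then (-1 : ℂ) else 1) * d x := by
  rw [← W_mul_of_disjoint, Submonoid.coe_mul, coe_W_lz, hd, Matrix.diagonal_mul_diagonal]
  intro k
  by_cases hk : k = i
  · subst hk
    exact Or.inr hv
  · exact Or.inl (Pi.single_eq_of_ne hk _)

theorem coe_R_diagonal {v : Label n} {d : Basis n → ℂ} (hd : (W ω v).1 = Matrix.diagonal d) :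
    (R ω v).1 = Matrix.diagonal fun x => (1 + (ω : ℂ) ^ 2) / 2 + (1 - (ω : ℂ) ^ 2) / 2 * d x := by
  rw [coe_R, sqrtMat, hd, ← Matrix.diagonal_one, ← Matrix.diagonal_smul, ← Matrix.diagonal_smul,
    Matrix.diagonal_add]
  simp

/-- On basis bits `x`, `y` this is `x ⊕ y = x + y - 2xy`, read as exponents of `ω²`. -/
theorem gateCZ_mul_R {i j : Fin n} (hij : i ≠ j) :
    gateCZ i j * R ω (lz i + lz j) = R ω (lz i) * R ω (lz j) := by
  have hι := ω.sq_sq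
  apply Subtype.ext
  rw [Submonoid.coe_mul, Submonoid.coe_mul, coe_R_diagonal (coe_W_lz i),
    coe_R_diagonal (coe_W_lz j), coe_R_diagonal (coe_W_lz_add (Pi.single_eq_of_ne hij _)
      (coe_W_lz j))]
  change matCZ i j * _ = _
  rw [matCZ, Matrix.diagonal_mul_diagonal, Matrix.diagonal_mul_diagonal]
  congr 1
  funext x
  by_cases hi : x i = 1 <;> by_cases hj : x j = 1 <;> simp only [hi, hj, and_true, and_false,
    if_true, if_false]
  · linear_combination -hι
  all_goals ring

/-- For bits of weight `w` the exponents of `ω²` are `w` plus the parity of `w` on the left and `w(3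
- w)` on the right; they agree modulo `4`. This expresses `R (lz i)` by roots of longer diagonal
Paulis. -/
theorem R_lz_mul_three {i j k : Fin n} (hij : i ≠ j) (hik : i ≠ k) (hjk : j ≠ k) :
    R ω (lz i) * (R ω (lz j) * R ω (lz k) * R ω (lz i + (lz j + lz k))) =
      R ω (lz i + lz j) * R ω (lz i + lz k) * R ω (lz j + lz k) := by
  have hι := ω.sq_sq
  apply Subtype.ext
  have hjk' := coe_W_lz_add (ω := ω) (Pi.single_eq_of_ne hjk (0, 1)) (coe_W_lz k)
  simp only [Submonoid.coe_mul, coe_R_diagonal (coe_W_lz _),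
    coe_R_diagonal (coe_W_lz_add (Pi.single_eq_of_ne hij _) (coe_W_lz j)),
    coe_R_diagonal (coe_W_lz_add (Pi.single_eq_of_ne hik _) (coe_W_lz k)),
    coe_R_diagonal hjk',
    coe_R_diagonal (coe_W_lz_add (i := i) (v := lz j + lz k) (by
      rw [Pi.add_apply, lz_of_ne hij, lz_of_ne hik, add_zero]) hjk'),
    Matrix.diagonal_mul_diagonal]
  congr 1
  funext x
  by_cases hi : x i = 1 <;> by_cases hj : x j = 1 <;> by_cases hk : x k = 1 <;>
    simp only [hi, hj, hk, if_true, if_false]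
  · linear_combination ((ω : ℂ) ^ 4 - 1) * hι
  all_goals ring

/-- Up to a phase, `ZH` is the inverse of the square root of the Pauli `Y`. -/
theorem Z_mul_H_mul_R (ω : EighthRoot) (i : Fin n) :
    W ω (lz i) * gateH i * R ω (Pi.single i (1, 1)) ∈ phases n := by
  have hι := ω.sq_sq
  refine ⟨(1 + (ω : ℂ) ^ 2) / (Real.sqrt 2 : ℂ), ?_⟩
  rw [Submonoid.coe_mul, Submonoid.coe_mul, coe_R_single, ← onQubit_sigma, sigma_z, sigma_y]
  change onQubit i matZ * onQubit i matH * _ = _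
  rw [onQubit_mul, onQubit_mul, ← onQubit_one i, ← onQubit_smul]
  congr 1
  ext a b
  fin_cases a <;> fin_cases b <;>
    simp [matH, matX, matZ, Matrix.mul_apply, Fin.sum_univ_two]
  · linear_combination (-(1 / 2) * (Real.sqrt 2 : ℂ)⁻¹) * hι
  · linear_combination (1 / 2 * (Real.sqrt 2 : ℂ)⁻¹) * hι
  · linear_combination (-(1 / 2) * (Real.sqrt 2 : ℂ)⁻¹) * hι
  · linear_combination (-(1 / 2) * (Real.sqrt 2 : ℂ)⁻¹) * hι

/-! ### Passing to the projective Clifford group -/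

theorem toProj_mul (A B : Clifford ω n) : toProj A * toProj B = toProj (B * A) := rfl

theorem toProj_one : toProj (1 : Clifford ω n) = 1 := rfl

theorem toProj_surjective (g : ProjClifford ω n) : ∃ A : Clifford ω n, toProj A = g := by
  obtain ⟨A, hA⟩ := QuotientGroup.mk_surjective g.unop
  exact ⟨A, by rw [toProj, hA, MulOpposite.op_unop]⟩

theorem toProj_eq_iff (A B : Clifford ω n) : toProj A = toProj B ↔ A.1⁻¹ * B.1 ∈ phases n := by
  rw [toProj, toProj, MulOpposite.op_inj, QuotientGroup.eq, Subgroup.mem_subgroupOf]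
  rfl

/-! ### Preimages in the unitary group and the centralizer as a stabilizer -/

/-- The preimage of a subgroup of the projective Clifford group. -/
def lift (G : Subgroup (ProjClifford ω n)) : Subgroup (U n) where
  carrier := {A | ∃ hA : A ∈ Clifford ω n, toProj ⟨A, hA⟩ ∈ G}
  one_mem' := ⟨one_mem _, one_mem G⟩
  mul_mem' := fun ⟨hA, hA'⟩ ⟨hB, hB'⟩ => ⟨mul_mem hA hB, mul_mem hB' hA'⟩
  inv_mem' := fun ⟨hA, hA'⟩ => ⟨inv_mem hA, inv_mem hA'⟩

theorem mem_lift {G : Subgroup (ProjClifford ω n)} {A : Clifford ω n} :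
    A.1 ∈ lift G ↔ toProj A ∈ G := ⟨fun ⟨_, hA⟩ => hA, fun hA => ⟨A.2, hA⟩⟩

theorem lift_le (G : Subgroup (ProjClifford ω n)) : lift G ≤ Clifford ω n := fun _ hA => hA.1

theorem phases_le_lift (G : Subgroup (ProjClifford ω n)) : phases n ≤ lift G := by
  intro A hA
  refine ⟨phases_le_clifford hA, ?_⟩
  have : toProj ⟨A, phases_le_clifford hA⟩ = (1 : ProjClifford ω n) := by
    rw [← toProj_one, toProj_eq_iff]
    simpa using hA
  rw [this]
  exact one_mem G

theorem gateH_mem_lift {G : Subgroup (ProjClifford ω n)} {i : Fin n} :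
    gateH i ∈ lift G ↔ h ω i ∈ G := mem_lift (A := ⟨gateH i, gateH_mem ω i⟩)

theorem R_lz_mem_lift {G : Subgroup (ProjClifford ω n)} {i : Fin n} :
    R ω (lz i) ∈ lift G ↔ s ω i ∈ G := by
  rw [← gateS_eq]
  exact mem_lift (A := ⟨gateS ω i, gateS_mem ω i⟩)

theorem gateCZ_mem_lift {G : Subgroup (ProjClifford ω n)} {i : Fin n} {hi : (i : ℕ) + 1 < n} :
    gateCZ i ⟨i + 1, hi⟩ ∈ lift G ↔ lam ω i hi ∈ G :=
  mem_lift (A := ⟨gateCZ i ⟨i + 1, hi⟩, gateCZ_mem ω (Fin.ne_of_val_ne (Nat.succ_ne_self _).symm)⟩)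

theorem Fixes.commute_R {A : U n} {v : Label n} (hA : Fixes ω A v) :
    A * R ω v = R ω v * A := by
  have h1 : A.1 * (W ω v).1 = (W ω v).1 * A.1 := congrArg Subtype.val hA
  apply Subtype.ext
  simp only [Submonoid.coe_mul, coe_R, sqrtMat, mul_add, add_mul, mul_smul_comm, smul_mul_assoc,
    mul_one, one_mul, h1]

/-- Conjugation by `A` can only multiply `R (lz i)` by a scalar `c`, and the spectrum `{1, ω²}` with
equal multiplicities leaves only `c = 1`. -/
theorem fixes_lz_of_commute_mod_phases {A P : U n} (hP : P ∈ phases n) {i : Fin n}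
    (hA : A * R ω (lz i) = R ω (lz i) * A * P) : Fixes ω A (lz i) := by
  have hι := ω.sq_sq
  obtain ⟨c, hc⟩ := hP
  have h1 : A * R ω (lz i) * A⁻¹ = P * R ω (lz i) := by
    rw [hA, mul_inv_eq_iff_eq_mul, mul_assoc, ← phases_comm ⟨c, hc⟩ A, ← mul_assoc,
      phases_comm ⟨c, hc⟩]
  have h2 : A * W ω (lz i) * A⁻¹ = P * P * W ω (lz i) := by
    rw [← R_mul_self, ← conj_mul, h1, mul_assoc, ← mul_assoc (R ω (lz i)) P,
      ← phases_comm ⟨c, hc⟩ (R ω (lz i))]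
    simp only [mul_assoc]
  have h3 : (A * R ω (lz i) * A⁻¹).1 = sqrtMat ω (A * W ω (lz i) * A⁻¹).1 := by
    have hAA : A.1 * (A⁻¹).1 = 1 := congrArg Subtype.val (mul_inv_cancel A)
    simp only [Submonoid.coe_mul, coe_R, sqrtMat, mul_add, add_mul, mul_smul_comm, smul_mul_assoc,
      mul_one, hAA]
  rw [h1, h2, Submonoid.coe_mul, Submonoid.coe_mul, Submonoid.coe_mul, hc, sqrtMat,
    smul_mul_smul_comm, one_mul, smul_mul_assoc, one_mul, smul_mul_assoc, one_mul,
    coe_R_diagonal (coe_W_lz i), coe_W_lz] at h3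
  have h4 := congrFun (congrFun h3 0) 0
  have h5 := congrFun (congrFun h3 (Pi.single i 1)) (Pi.single i 1)
  simp at h4 h5
  -- The entries on bits `0` and `1` add up to `c(1 + ω²) = 1 + ω²`; the factor `(1 - ω²)/2` is the
  -- inverse of `1 + ω²`.
  have h6 : c = 1 := by
    linear_combination ((1 - (ω : ℂ) ^ 2) / 2) * (h4 + h5) + (c - 1) / 2 * hι
  have h7 : P = 1 := Subtype.ext (by rw [hc, h6, one_smul]; rfl)
  rw [h7, one_mul, one_mul, mul_inv_eq_iff_eq_mul] at h2
  exact h2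

theorem mem_lift_centralizer [NeZero n] {A : U n} :
    A ∈ lift (Subgroup.centralizer {s ω (0 : Fin n)}) ↔ A ∈ Clifford ω n ∧ Fixes ω A (lz 0) := by
  constructor
  · rintro ⟨hA, hA'⟩
    refine ⟨hA, ?_⟩
    rw [Subgroup.mem_centralizer_singleton_iff, s, toProj_mul, toProj_mul, toProj_eq_iff] at hA'
    refine fixes_lz_of_commute_mod_phases hA' ?_
    simp only [Subgroup.coe_mul, gateS_eq]
    group
  · rintro ⟨hA, hA'⟩
    refine ⟨hA, ?_⟩
    rw [Subgroup.mem_centralizer_singleton_iff, s, toProj_mul, toProj_mul]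
    congr 1
    apply Subtype.ext
    simp only [Subgroup.coe_mul, gateS_eq]
    exact hA'.commute_R.symm

theorem centralizer_le [NeZero n] {G : Subgroup (ProjClifford ω n)}
    (hG : ∀ A ∈ Clifford ω n, Fixes ω A (lz 0) → A ∈ lift G) :
    Subgroup.centralizer {s ω (0 : Fin n)} ≤ G := by
  intro g hg
  obtain ⟨A, rfl⟩ := toProj_surjective g
  rw [← mem_lift] at hg ⊢
  obtain ⟨hA, hA'⟩ := mem_lift_centralizer.mp hg
  exact hG A hA hA'

theorem h_mem_centralizer [NeZero n] {i : Fin n} (hi : i ≠ 0) :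
    h ω i ∈ Subgroup.centralizer {s ω (0 : Fin n)} :=
  gateH_mem_lift.mp (mem_lift_centralizer.mpr ⟨gateH_mem ω i, gateH_fixes hi _⟩)

theorem sp_lz_lz (i j : Fin n) : sp (lz i) (lz j) = 0 := by
  rw [sp_single]
  by_cases hij : j = i
  · subst hij; rw [lz_self]; decide
  · rw [lz_of_ne hij]; decide

theorem s_mem_centralizer [NeZero n] (i : Fin n) :
    s ω i ∈ Subgroup.centralizer {s ω (0 : Fin n)} :=
  R_lz_mem_lift.mp (mem_lift_centralizer.mpr ⟨R_mem_clifford _, R_commute (sp_lz_lz i 0)⟩)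

theorem lam_mem_centralizer [NeZero n] (i : Fin n) (hi : (i : ℕ) + 1 < n) :
    lam ω i hi ∈ Subgroup.centralizer {s ω (0 : Fin n)} :=
  gateCZ_mem_lift.mp (mem_lift_centralizer.mpr
    ⟨gateCZ_mem ω (Fin.ne_of_val_ne (Nat.succ_ne_self _).symm), gateCZ_fixes_lz _ _ _⟩)

/-- The gates `s` give the roots of `Z`, conjugation by `h` those of `X`, and `Λ` those of
neighbouring `ZZ`, as `R_mem_of_suppGE` requires. -/
theorem R_mem_lift_of_tailGates {G : Subgroup (ProjClifford ω n)} (hG : tailGates ω n ⊆ G) :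
    ∀ v : Label n, SuppGE 1 v → R ω v ∈ lift G := by
  have hz : ∀ i : Fin n, 1 ≤ (i : ℕ) → R ω (lz i) ∈ lift G := fun i hi =>
    R_lz_mem_lift.mpr (hG ⟨i, by omega, Or.inr (Or.inl rfl)⟩)
  refine R_mem_of_suppGE (phases_le_lift G) 1 (fun i hi => ?_) (fun i hi hi1 => ?_)
  · refine R_single_mem (phases_le_lift G) ?_ (hz i hi)
    exact R_mem_of_moves (phases_le_lift G)
      (gateH_mem_lift.mpr (hG ⟨i, by omega, Or.inl rfl⟩)) (gateH_moves_lz i) (hz i hi)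
  · have h1 := gateCZ_mul_R (ω := ω) (i := i) (j := ⟨i + 1, hi⟩)
      (Fin.ne_of_val_ne (Nat.succ_ne_self _).symm)
    have h2 : gateCZ i ⟨i + 1, hi⟩ ∈ lift G :=
      gateCZ_mem_lift.mpr (hG ⟨i, by omega, Or.inr (Or.inr ⟨hi, rfl⟩)⟩)
    rw [← Subgroup.mul_mem_cancel_left _ h2, h1]
    exact mul_mem (hz i hi1) (hz _ (by simp))

/-- The element `A` is central in the group generated by `A`, `B`, `D`, so its powers collect to a
single `A`. This isolates `A` when only `A * B⁻¹`, but neither factor, is known to lie in a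
subgroup. -/
theorem conj_conj_of_commute {G : Type*} [Group G] {A B D : G} (hAB : Commute A B)
    (hAD : Commute A D) : A * B⁻¹ * (D * (A * B⁻¹) * D⁻¹) * (A * B⁻¹)⁻¹ =
      A * ((B⁻¹ * D) * B * (B⁻¹ * D)⁻¹)⁻¹ := by
  have e1 : Commute A (B⁻¹ * D * B⁻¹ * D⁻¹ * B) :=
    (((hAB.inv_right.mul_right hAD).mul_right hAB.inv_right).mul_right
      hAD.inv_right).mul_right hAB
  have e2 : Commute A (B⁻¹ * D) := hAB.inv_right.mul_right hAD
  calc A * B⁻¹ * (D * (A * B⁻¹) * D⁻¹) * (A * B⁻¹)⁻¹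
      = A * ((B⁻¹ * D) * A) * (B⁻¹ * D⁻¹ * B) * A⁻¹ := by group
    _ = A * (A * (B⁻¹ * D * B⁻¹ * D⁻¹ * B)) * A⁻¹ := by rw [← e2.eq]; group
    _ = A * (B⁻¹ * D * B⁻¹ * D⁻¹ * B) := by rw [e1.eq, ← mul_assoc A, mul_inv_cancel_right, e1.eq]
    _ = A * ((B⁻¹ * D) * B * (B⁻¹ * D)⁻¹)⁻¹ := by group

/-- The square root of `Z` on the first qubit lies in every subgroup containing all gates on the
other qubits and the controlled `Z` gate on the first two qubits. -/
theorem R_lz_zero_mem {K : Subgroup (U (n + 2))} (hK : phases (n + 2) ≤ K)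
    (htail : ∀ v : Label (n + 2), SuppGE 1 v → R ω v ∈ K) (hH : gateH 1 ∈ K)
    (hCZ : gateCZ 0 1 ∈ K) : R ω (lz (0 : Fin (n + 2))) ∈ K := by
  have h01 : (0 : Fin (n + 2)) ≠ 1 := by simp
  have hz1 : R ω (lz (1 : Fin (n + 2))) ∈ K := htail _ (suppGE_single (by simp) _)
  set A : U (n + 2) := R ω (lz 0) with hAdef
  set B : U (n + 2) := R ω (lz 0 + lz 1) with hBdef
  set D : U (n + 2) := gateH 1 with hDdef
  have hAB : Commute A B := Fixes.commute_R
    (R_commute (by rw [sp_add_right, sp_lz_lz, sp_lz_lz, add_zero]))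
  have hAD : Commute A D := (gateH_fixes h01.symm _).commute_R.symm
  have hA1 : A * R ω (lz 1) = R ω (lz 1) * A := Fixes.commute_R (R_commute (sp_lz_lz _ _))
  -- By `gateCZ_mul_R`, `CZ` is `A * B⁻¹` times the phase gate on the second qubit, which is
  -- available.
  have ha : A * B⁻¹ ∈ K := by
    have h1 := gateCZ_mul_R (ω := ω) h01
    have h2 : A * B⁻¹ = (R ω (lz 1))⁻¹ * gateCZ 0 1 := by
      rw [mul_inv_eq_iff_eq_mul, mul_assoc, h1, eq_inv_mul_iff_mul_eq]
      exact hA1.symm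
    rw [h2]
    exact mul_mem (inv_mem hz1) hCZ
  have hc : A * B⁻¹ * (D * (A * B⁻¹) * D⁻¹) * (A * B⁻¹)⁻¹ =
      A * ((B⁻¹ * D) * B * (B⁻¹ * D)⁻¹)⁻¹ := conj_conj_of_commute hAB hAD
  -- The Hadamard turns `Z ⊗ Z` into `Z ⊗ X`, and the transvection `B⁻¹` then removes the `Z` on the
  -- first qubit, leaving a root already in `K`.
  have hm : Moves ω (B⁻¹ * D) (lz 0 + lz 1) (lz 1 + lx 1) := by
    have h1 : Moves ω D (lz 0 + lz 1) (lz 0 + lx 1) :=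
      (moves_of_commute (gateH_fixes h01.symm _)).add (gateH_moves_lz 1)
    have h2 : Moves ω B (lz 1 + lx 1) (lz 0 + lz 1 + (lz 1 + lx 1)) := by
      refine R_moves_of_sp_eq_one ?_
      rw [sp_add_right, sp_single, sp_single]
      simp only [Pi.add_apply, lz_self, lz_of_ne h01.symm]
      decide
    have h3 : (lz 0 + lz 1 + (lz 1 + lx 1) : Label (n + 2)) = lz 0 + lx 1 := by
      rw [add_assoc, label_add_add]
    rw [h3] at h2
    exact h1.mul h2.inv
  have hy : R ω (lz 1 + lx 1 : Label (n + 2)) ∈ K :=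
    htail _ ((suppGE_single (by simp) _).add (suppGE_single (by simp) _))
  have h1 := mul_mem (mul_mem ha (mul_mem (mul_mem hH ha) (inv_mem hH))) (inv_mem ha)
  rw [hc] at h1
  exact (Subgroup.mul_mem_cancel_right _ (inv_mem ((conj_R_mem_iff hK hm).mpr hy))).mp h1

/-! ### The centralizer in terms of standard gates -/

theorem suppGE_one_eq_zero {v : Label 1} (hv : SuppGE 1 v) : v = 0 :=
  funext fun i => hv i i.2

theorem centralizer_one : Subgroup.centralizer {s ω (0 : Fin 1)} =
    Subgroup.closure {s ω (0 : Fin 1)} := by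
  apply le_antisymm
  · refine centralizer_le fun A hAC hA => mem_of_fixes_lz_of_generators (phases_le_lift _)
      (lift_le _) (R_lz_mem_lift.mpr (Subgroup.subset_closure (Set.mem_singleton _))) (fun v hv => ?_)
      (fun h0 => absurd h0 (by norm_num)) hAC hA
    rw [suppGE_one_eq_zero hv, R_zero]
    exact one_mem _
  · rw [Subgroup.closure_le, Set.singleton_subset_iff]
    exact s_mem_centralizer 0

/-- The generators of the centralizer, without `s₁`. -/
def centGates (ω : EighthRoot) (n : ℕ) [NeZero n] : Set (ProjClifford ω n) :=
  {g | ∃ i : Fin n, i ≠ 0 ∧ g = h ω i} ∪ {g | ∃ i : Fin n, i ≠ 0 ∧ g = s ω i} ∪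
    {g | ∃ (i : Fin n) (hi : (i : ℕ) + 1 < n), g = lam ω i hi}

theorem tailGates_subset_centGates [NeZero n] : tailGates ω n ⊆ centGates ω n := by
  rintro g ⟨i, hi, rfl | rfl | ⟨hi', rfl⟩⟩
  · exact Or.inl (Or.inl ⟨i, fun h0 => hi (by simp [h0]), rfl⟩)
  · exact Or.inl (Or.inr ⟨i, fun h0 => hi (by simp [h0]), rfl⟩)
  · exact Or.inr ⟨i, hi', rfl⟩

theorem centralizer_le_of_gates {G : Subgroup (ProjClifford ω (n + 2))}
    (htail : tailGates ω (n + 2) ⊆ G) (hz : s ω 0 ∈ G) {t : Label (n + 2)} (ht : SuppGE 1 t)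
    (ht0 : t ≠ 0) (htG : R ω (lz 0 + t) ∈ lift G) :
    Subgroup.centralizer {s ω (0 : Fin (n + 2))} ≤ G :=
  centralizer_le fun _ hAC hA => mem_of_fixes_lz_of_generators (phases_le_lift _)
    (lift_le _) (R_lz_mem_lift.mpr hz) (R_mem_lift_of_tailGates htail)
    (fun _ => ⟨t, ht, ht0, htG⟩) hAC hA

theorem centralizer_le_closure_centGates :
    Subgroup.centralizer {s ω (0 : Fin (n + 2))} ≤ Subgroup.closure (centGates ω (n + 2)) := by
  have h01 : (0 : Fin (n + 2)) ≠ 1 := by simp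
  have htail : tailGates ω (n + 2) ⊆ Subgroup.closure (centGates ω (n + 2)) :=
    tailGates_subset_centGates.trans Subgroup.subset_closure
  have hR := R_mem_lift_of_tailGates htail
  have hCZ : gateCZ 0 1 ∈ lift (Subgroup.closure (centGates ω (n + 2))) :=
    gateCZ_mem_lift (i := 0) (hi := by simp) |>.mpr
      (Subgroup.subset_closure (Or.inr ⟨0, by simp, rfl⟩))
  have hH : gateH 1 ∈ lift (Subgroup.closure (centGates ω (n + 2))) :=
    gateH_mem_lift.mpr (htail ⟨1, by simp, Or.inl rfl⟩)
  have hz := R_lz_zero_mem (phases_le_lift _) hR hH hCZ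
  refine centralizer_le_of_gates htail (R_lz_mem_lift.mp hz) (t := lz 1)
    (suppGE_single (by simp) _) (lz_ne_zero 1) ?_
  rw [← Subgroup.mul_mem_cancel_left _ hCZ, gateCZ_mul_R h01]
  exact mul_mem hz (hR _ (suppGE_single (by simp) _))

/-! ### The gates on the first qubit -/

theorem tensorMat_commute_onQubit {i : Fin n} {f : Fin n → Matrix (Fin 2) (Fin 2) ℂ} (hf : f i = 1)
    (A : Matrix (Fin 2) (Fin 2) ℂ) : onQubit i A * tensorMat f = tensorMat f * onQubit i A := by
  rw [onQubit, tensorMat_mul, tensorMat_mul]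
  congr 1
  funext k
  by_cases hk : k = i
  · subst hk; simp [hf]
  · simp [hk]

theorem gateH_zero_fixes [NeZero n] {v : Label n} (hv : SuppGE 1 v) :
    Fixes ω (gateH (0 : Fin n)) v :=
  Subtype.ext (tensorMat_commute_onQubit (by rw [hv 0 (by simp), sigma_zero]) _)

theorem gateS_zero_fixes [NeZero n] {v : Label n} (hv : SuppGE 1 v) :
    Fixes ω (gateS ω (0 : Fin n)) v := by
  rw [gateS_eq]
  exact R_commute (sp_lz_zero_of_suppGE hv)

theorem gateH_mem_of_R_mem {K : Subgroup (U n)} (hK : phases n ≤ K) {i : Fin n}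
    (hs : ∀ a, R ω (Pi.single i a) ∈ K) : gateH i ∈ K := by
  have h1 := hK (Z_mul_H_mul_R ω i)
  rwa [Subgroup.mul_mem_cancel_right _ (hs _),
    Subgroup.mul_mem_cancel_left _ (W_mem_of_R_mem (hs _))] at h1

theorem gateCZ_mem_of_R_mem {K : Subgroup (U n)} {i j : Fin n} (hij : i ≠ j)
    (hi : R ω (lz i) ∈ K) (hj : R ω (lz j) ∈ K) (hzz : R ω (lz i + lz j) ∈ K) :
    gateCZ i j ∈ K := by
  rw [← Subgroup.mul_mem_cancel_right _ hzz, gateCZ_mul_R hij]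
  exact mul_mem hi hj

/-- Every such gate is a product of phases and of roots `R v`, or their inverses, with `v` trivial
on the first qubit; it thus lies in the centralizer of `C`. -/
theorem commute_tailGates {C : Clifford ω n} (hC : ∀ v, SuppGE 1 v → Fixes ω C.1 v)
    {g : ProjClifford ω n} (hg : g ∈ tailGates ω n) : Commute (toProj C) g := by
  have hK : phases n ≤ Subgroup.centralizer {C.1} := fun A hA =>
    Subgroup.mem_centralizer_singleton_iff.mpr (phases_comm hA _)
  have hR : ∀ v, SuppGE 1 v → R ω v ∈ Subgroup.centralizer {C.1} := fun v hv =>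
    Subgroup.mem_centralizer_singleton_iff.mpr (hC v hv).commute_R.symm
  have hs : ∀ i : Fin n, (i : ℕ) ≠ 0 → ∀ a, SuppGE 1 (Pi.single i a : Label n) := fun i hi a =>
    suppGE_single (Nat.one_le_iff_ne_zero.mpr hi) a
  have key : ∀ A : Clifford ω n, A.1 ∈ Subgroup.centralizer {C.1} →
      Commute (toProj C) (toProj A) := by
    intro A hA
    rw [Commute, SemiconjBy, toProj_mul, toProj_mul]
    congr 1
    exact Subtype.ext (Subgroup.mem_centralizer_singleton_iff.mp hA)
  obtain ⟨i, hi, rfl | rfl | ⟨hi', rfl⟩⟩ := hg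
  · exact key ⟨gateH i, _⟩ (gateH_mem_of_R_mem hK fun a => hR _ (hs i hi a))
  · refine key ⟨gateS ω i, _⟩ ?_
    change gateS ω i ∈ _
    rw [gateS_eq]
    exact hR _ (hs i hi _)
  · exact key ⟨gateCZ i ⟨i + 1, hi'⟩, _⟩ (gateCZ_mem_of_R_mem
      (Fin.ne_of_val_ne (Nat.succ_ne_self _).symm) (hR _ (hs i hi _)) (hR _ (hs _ (by simp) _))
      (hR _ ((hs i hi _).add (hs _ (by simp) _))))

/-! ### Relations between the one-qubit classes -/

theorem h_mul_h (i : Fin n) : h ω i * h ω i = 1 := by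
  rw [h, toProj_mul, ← toProj_one]
  exact congrArg toProj (Subtype.ext (gateH_mul_self i))

theorem W_mem_clifford (v : Label n) : W ω v ∈ Clifford ω n := by
  rw [← R_mul_self]
  exact mul_mem (R_mem_clifford v) (R_mem_clifford v)

theorem s_mul_s (i : Fin n) : s ω i * s ω i = toProj ⟨W ω (lz i), W_mem_clifford _⟩ := by
  rw [s, toProj_mul]
  refine congrArg toProj (Subtype.ext ?_)
  change gateS ω i * gateS ω i = W ω (lz i)
  rw [gateS_eq, R_mul_self]

theorem s_pow_four (i : Fin n) : s ω i ^ 4 = 1 := by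
  rw [show (4 : ℕ) = 2 * 2 from rfl, pow_mul, pow_two, pow_two, s_mul_s, toProj_mul, ← toProj_one]
  exact congrArg toProj (Subtype.ext (W_mul_self _))

theorem s_mul_s_ne_one (i : Fin n) : s ω i * s ω i ≠ 1 := by
  rw [s_mul_s, ← toProj_one, Ne, toProj_eq_iff]
  intro h1
  have h2 := phases_comm h1 (W ω (lx i))
  rw [Subgroup.coe_one, mul_one, W_inv, anticommute_W (by rw [sp_comm, sp_lx_lz])] at h2
  exact neg_ne_self_unitary _ h2

theorem toProj_eq_of_smul {A B : Clifford ω n} {c : ℂ} (hc : A.1.1 = c • B.1.1) :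
    toProj A = toProj B := by
  symm
  rw [toProj_eq_iff]
  refine ⟨c, ?_⟩
  rw [Submonoid.coe_mul, hc, mul_smul_comm, ← Submonoid.coe_mul, inv_mul_cancel]
  rfl

/-- The relation `s h s h s = h` in the projective Clifford group. -/
theorem s_h_s_h_s (i : Fin n) : s ω i * h ω i * s ω i * h ω i * s ω i = h ω i := by
  have hι := ω.sq_sq
  have h2 := sqrt_two_sq
  rw [h, s, toProj_mul, toProj_mul, toProj_mul, toProj_mul]
  refine toProj_eq_of_smul (c := (1 + (ω : ℂ) ^ 2) * (Real.sqrt 2 : ℂ)⁻¹) ?_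
  change onQubit i (matS ω) * (onQubit i matH * (onQubit i (matS ω) * (onQubit i matH *
    onQubit i (matS ω)))) = _ • onQubit i matH
  rw [onQubit_mul, onQubit_mul, onQubit_mul, onQubit_mul, ← onQubit_smul]
  congr 1
  ext a b
  fin_cases a <;> fin_cases b <;>
    simp [matH, matS, Matrix.mul_apply, Fin.sum_univ_two]
  · ring
  · linear_combination (-(Real.sqrt 2 : ℂ)⁻¹ * (Real.sqrt 2 : ℂ)⁻¹) * hι
  · linear_combination (-(Real.sqrt 2 : ℂ)⁻¹ * (Real.sqrt 2 : ℂ)⁻¹) * hι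
  · linear_combination ((Real.sqrt 2 : ℂ)⁻¹ * (Real.sqrt 2 : ℂ)⁻¹ * (1 + (ω : ℂ) ^ 2)) * hι

/-- The element `s₁³ h₁ s₁ h₁ s₁`. -/
def sqrtY (ω : EighthRoot) (n : ℕ) [NeZero n] : ProjClifford ω n :=
  s ω 0 ^ 3 * h ω 0 * s ω 0 * h ω 0 * s ω 0

theorem sqrtY_eq [NeZero n] : sqrtY ω n = s ω 0 ^ 2 * h ω 0 := by
  rw [← s_h_s_h_s, sqrtY, pow_succ]
  simp only [mul_assoc]

theorem h_mul_s_inv [NeZero n] : (h ω (0 : Fin n) * s ω 0)⁻¹ = s ω 0 ^ 3 * h ω 0 := by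
  rw [inv_eq_iff_mul_eq_one, mul_assoc, ← mul_assoc (s ω 0), ← pow_succ', s_pow_four, one_mul,
    h_mul_h]

/-- The word defining `sqrtY` is `(hs)⁻¹ * s * (hs)` as it stands, because `(hs)⁻¹ = s³h`. -/
theorem conj_sqrtY [NeZero n] :
    (h ω (0 : Fin n) * s ω 0) * sqrtY ω n * (h ω (0 : Fin n) * s ω 0)⁻¹ = s ω 0 := by
  rw [mul_inv_eq_iff_eq_mul, ← inv_mul_eq_iff_eq_mul (a := h ω (0 : Fin n) * s ω 0) |>.mp]
  rw [h_mul_s_inv, sqrtY]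
  simp only [mul_assoc]

/-- The element `sqrtY = s²h` is a product of two involutions, and conjugation by one of them
inverts it. -/
theorem h_sqrtY_h [NeZero n] : h ω (0 : Fin n) * sqrtY ω n * (h ω (0 : Fin n))⁻¹ =
    (sqrtY ω n)⁻¹ := by
  have h1 : (h ω (0 : Fin n))⁻¹ = h ω 0 := inv_eq_of_mul_eq_one_left (h_mul_h 0)
  have h2 : (s ω (0 : Fin n) ^ 2)⁻¹ = s ω 0 ^ 2 := by
    rw [inv_eq_iff_mul_eq_one, ← pow_add, s_pow_four]
  rw [sqrtY_eq, mul_inv_rev, h1, h2, mul_assoc, mul_assoc, h_mul_h, mul_one]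

/-! ### The element `M` -/

/-- Reading the circuit as a matrix product reverses it. The factor `s₂²` is `Z` on the second qubit
and becomes `X` on passing the Hadamard, which leaves the same controlled `X`, `H * CZ * H`, at both
ends. -/
theorem exists_M (ω : EighthRoot) (n : ℕ) : ∃ A : Clifford ω (n + 2), toProj A = M ω n ∧
    A.1 = gateH 1 * gateCZ 0 1 * gateH 1 * W ω (lz 0) * gateH 0 * W ω (lx 1) *
      (gateH 1 * gateCZ 0 1 * gateH 1) := by
  let a (i : Fin (n + 2)) : Clifford ω (n + 2) := ⟨gateH i, gateH_mem ω i⟩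
  let b (i : Fin (n + 2)) : Clifford ω (n + 2) := ⟨gateS ω i, gateS_mem ω i⟩
  let c : Clifford ω (n + 2) := ⟨gateCZ 0 1, gateCZ_mem ω (by simp)⟩
  refine ⟨a 1 * (c * (a 1 * ((b 0 * b 0) * (a 0 * (a 1 * ((b 1 * b 1) * (c * a 1))))))), ?_, ?_⟩
  · rw [M, pow_two, pow_two]
    rfl
  · have h1 := gateH_mul_Z (ω := ω) (1 : Fin (n + 2))
    simp only [Subgroup.coe_mul, a, b, c, gateS_eq, R_mul_self]
    rw [← mul_assoc (gateH 1) (W ω (lz 1)), h1]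
    simp only [mul_assoc]

/-- Conjugating `M` by `h₁ s₁` gives the square root of `Z ⊗ X`, up to a Pauli operator. -/
theorem conj_M_mem_iff {G : Subgroup (ProjClifford ω (n + 2))} (hG : tailGates ω (n + 2) ⊆ G) :
    (h ω (0 : Fin (n + 2)) * s ω 0) * M ω n * (h ω (0 : Fin (n + 2)) * s ω 0)⁻¹ ∈ G ↔ R ω (lz 0 + lx 1) ∈ lift G := by
  have h01 : (0 : Fin (n + 2)) ≠ 1 := by simp
  have hX : SuppGE 1 (lx 1 : Label (n + 2)) := suppGE_single (by simp) _
  obtain ⟨A, hA, hA'⟩ := exists_M ω n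
  let C : Clifford ω (n + 2) := ⟨gateS ω 0, gateS_mem ω 0⟩ * ⟨gateH 0, gateH_mem ω 0⟩
  have hC : C.1 = gateS ω 0 * gateH 0 := rfl
  have e1 : (h ω (0 : Fin (n + 2)) * s ω 0) * M ω n * (h ω (0 : Fin (n + 2)) * s ω 0)⁻¹ = toProj (C⁻¹ * (A * C)) := by
    rw [← hA]; rfl
  rw [e1, ← mem_lift]
  set K := lift G
  have hP := Z_mul_H_mul_R ω (0 : Fin (n + 2))
  set Y : U (n + 2) := R ω (Pi.single 0 (1, 1)) with hY
  set P : U (n + 2) := W ω (lz 0) * gateH 0 * Y with hPdef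
  set D : U (n + 2) := gateH 1 * gateCZ 0 1 * gateH 1 with hD
  set X : U (n + 2) := W ω (lx 1) with hXdef
  -- The controlled `X` operator `D` is an involution commuting with `X` on its target. Writing
  -- `D⁻¹` exhibits `M` as a conjugate by `D`, times `X`.
  have hDX : X * D = D⁻¹ * X := by
    have h1 : gateH 1 * X = W ω (lz 1) * gateH 1 := gateH_mul_X 1
    have h2 : gateH 1 * W ω (lz 1) = X * gateH 1 := gateH_mul_Z 1
    have h3 : gateCZ 0 1 * W ω (lz (1 : Fin (n + 2))) = W ω (lz 1) * gateCZ 0 1 :=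
      gateCZ_fixes_lz 0 1 1
    have h4 : D⁻¹ = D := by
      rw [inv_eq_iff_mul_eq_one, hD]
      simp only [← mul_assoc]
      rw [mul_assoc (gateH 1 * gateCZ 0 1), gateH_mul_self, mul_one, mul_assoc (gateH 1),
        gateCZ_mul_self, mul_one, gateH_mul_self]
    rw [h4]
    calc X * D = X * gateH 1 * gateCZ 0 1 * gateH 1 := by rw [hD]; simp only [mul_assoc]
      _ = gateH 1 * (W ω (lz 1) * gateCZ 0 1) * gateH 1 := by rw [← h2, mul_assoc (gateH 1)]
      _ = gateH 1 * gateCZ 0 1 * (W ω (lz 1) * gateH 1) := by rw [← h3]; simp only [mul_assoc]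
      _ = D * X := by rw [← h1, hD]; simp only [mul_assoc]
  have hCX : X * C.1 = C.1 * X := ((gateS_zero_fixes hX).mul (gateH_zero_fixes hX)).symm
  -- Since `ZH` is the phase `P` times `Y⁻¹`, the conjugate of `M` is a phase times the inverse of a
  -- conjugated root times `X`. The phase and `X` lie in `K`, so only the label of that root
  -- matters.
  have e2 : C.1⁻¹ * (A.1 * C.1) = P * ((C.1⁻¹ * D) * Y * (C.1⁻¹ * D)⁻¹)⁻¹ * X := by
    have h1 : W ω (lz 0) * gateH 0 = P * Y⁻¹ := by rw [hPdef, mul_inv_cancel_right]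
    calc C.1⁻¹ * (A.1 * C.1)
        = C.1⁻¹ * D * (W ω (lz 0) * gateH 0) * (X * D) * C.1 := by
          rw [hA']; simp only [mul_assoc]
      _ = (C.1⁻¹ * D) * P * Y⁻¹ * D⁻¹ * (X * C.1) := by rw [h1, hDX]; simp only [mul_assoc]
      _ = P * ((C.1⁻¹ * D) * Y * (C.1⁻¹ * D)⁻¹)⁻¹ * X := by
          rw [← phases_comm hP, hCX]; group
  -- `D` spreads `Y` on the control to `Y ⊗ X`, and `C`, which sends `Z` on the first qubit to `Y`,
  -- carries `Z ⊗ X` to the same label.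
  have hmD : Moves ω D (Pi.single 0 (1, 1)) (lx 0 + lx 1 + lz 0) := by
    have h1 : ∀ a, Moves ω (gateH 1) (Pi.single (0 : Fin (n + 2)) a) (Pi.single 0 a) := fun a =>
      moves_of_commute (gateH_fixes h01.symm a)
    have h2 : Moves ω (gateCZ 0 1) (lx (0 : Fin (n + 2)) + lz 0) (lx 0 + lz 1 + lz 0) :=
      (gateCZ_moves_lx h01).add (moves_of_commute (gateCZ_fixes_lz 0 1 0))
    have h3 : (Pi.single 0 (1, 1) : Label (n + 2)) = lx 0 + lz 0 := by
      rw [← Pi.single_add]; rfl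
    rw [h3]
    have h4 := (((h1 _).add (h1 _)).mul h2).mul
      (((h1 (1, 0)).add (gateH_moves_lz 1)).add (h1 (0, 1)))
    rwa [← mul_assoc] at h4
  have hmC : Moves ω C.1 (lz 0 + lx 1) (lx 0 + lx 1 + lz 0) := by
    have h1 : Moves ω (gateH 0) (lz 0 + lx 1 : Label (n + 2)) (lx 0 + lx 1) :=
      (gateH_moves_lz 0).add (moves_of_commute (gateH_fixes h01 _))
    have h2 : Moves ω (gateS ω 0) (lx 0 + lx 1 : Label (n + 2)) (lx 0 + lx 1 + lz 0) := by
      rw [gateS_eq, add_comm _ (lz 0)]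
      refine R_moves_of_sp_eq_one ?_
      rw [sp_add_right, sp_comm, sp_lx_lz, sp_lz_zero_of_suppGE hX, add_zero]
    exact h1.mul h2
  rw [Subgroup.coe_mul, Subgroup.coe_mul, Subgroup.coe_inv, e2,
    Subgroup.mul_mem_cancel_right _ (W_mem_of_R_mem (R_mem_lift_of_tailGates hG _ hX)),
    Subgroup.mul_mem_cancel_left _ (phases_le_lift G hP), inv_mem_iff,
    conj_R_mem_iff (phases_le_lift G) (hmD.mul hmC.inv)]

theorem conj_M_mem_centralizer : (h ω (0 : Fin (n + 2)) * s ω 0) * M ω n * (h ω (0 : Fin (n + 2)) * s ω 0)⁻¹ ∈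
    Subgroup.centralizer {s ω (0 : Fin (n + 2))} := by
  have htail : tailGates ω (n + 2) ⊆ Subgroup.centralizer {s ω (0 : Fin (n + 2))} := by
    rintro g ⟨i, hi, rfl | rfl | ⟨hi', rfl⟩⟩
    · exact h_mem_centralizer fun h0 => hi (by simp [h0])
    · exact s_mem_centralizer i
    · exact lam_mem_centralizer i hi'
  rw [conj_M_mem_iff htail, mem_lift_centralizer]
  refine ⟨R_mem_clifford _, R_commute ?_⟩
  rw [sp_comm, sp_add_right, sp_self, sp_lz_zero_of_suppGE (suppGE_single (by simp) _), add_zero]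

/-! ### The subgroup `F` -/

theorem tailGates_two : tailGates ω 2 = {h ω 1, s ω 1} := by
  ext g
  constructor
  · rintro ⟨i, hi, hg⟩
    obtain rfl : i = 1 := by omega
    rcases hg with rfl | rfl | ⟨hi', rfl⟩
    · exact Or.inl rfl
    · exact Or.inr rfl
    · exact absurd hi' (by decide)
  · rintro (rfl | rfl)
    · exact ⟨1, by simp, Or.inl rfl⟩
    · exact ⟨1, by simp, Or.inr (Or.inl rfl)⟩

theorem F_two : F ω 2 = Subgroup.closure ({M ω 0, sqrtY ω 2} ∪ tailGates ω 2) := by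
  rw [F, tailGates_two]
  congr 1
  ext g
  simp only [Set.mem_insert_iff, Set.mem_singleton_iff, Set.mem_union]
  change g = h ω 1 ∨ g = s ω 1 ∨ g = sqrtY ω 2 ∨ g = M ω 0 ↔ _
  tauto

theorem tailGates_subset_F : tailGates ω (n + 2) ⊆ F ω (n + 2) := by
  match n with
  | 0 => rw [F_two]; exact Set.subset_union_right.trans Subgroup.subset_closure
  | n + 1 => exact Set.subset_union_right.trans Subgroup.subset_closure

theorem M_mem_F : M ω n ∈ F ω (n + 2) := by
  match n with
  | 0 => rw [F_two]; exact Subgroup.subset_closure (Or.inl (Or.inl rfl))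
  | n + 1 => exact Subgroup.subset_closure (Or.inl rfl)

theorem commute_h_mul_s_tailGates [NeZero n] {g : ProjClifford ω n} (hg : g ∈ tailGates ω n) :
    (h ω (0 : Fin n) * s ω 0) * g * (h ω (0 : Fin n) * s ω 0)⁻¹ = g := by
  rw [mul_inv_eq_iff_eq_mul]
  exact (commute_tailGates (C := ⟨gateH 0, gateH_mem ω 0⟩) (fun _ => gateH_zero_fixes) hg).mul_left
    (commute_tailGates (C := ⟨gateS ω 0, gateS_mem ω 0⟩) (fun _ => gateS_zero_fixes) hg)

theorem tailGates_subset_centralizer :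
    tailGates ω (n + 2) ⊆ Subgroup.centralizer {s ω (0 : Fin (n + 2))} := by
  rintro g ⟨i, hi, rfl | rfl | ⟨hi', rfl⟩⟩
  · exact h_mem_centralizer fun h0 => hi (by simp [h0])
  · exact s_mem_centralizer i
  · exact lam_mem_centralizer i hi'

/-- On at least three qubits, the first phase gate is generated by the gates on the other qubits
and the square root of `Z ⊗ X`. -/
theorem s_zero_mem {G : Subgroup (ProjClifford ω (n + 3))} (hG : tailGates ω (n + 3) ⊆ G)
    (hZX : R ω (lz 0 + lx 1) ∈ lift G) : s ω 0 ∈ G := by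
  have h01 : (0 : Fin (n + 3)) ≠ 1 := by simp
  have hval : ((2 : Fin (n + 3)) : ℕ) = 2 := Nat.mod_eq_of_lt (by omega : 2 < n + 3)
  have h02 : (0 : Fin (n + 3)) ≠ 2 := Fin.ne_of_val_ne (by rw [hval]; simp)
  have h12 : (1 : Fin (n + 3)) ≠ 2 := Fin.ne_of_val_ne (by rw [hval]; simp)
  have htail := R_mem_lift_of_tailGates hG
  have hK := phases_le_lift G
  have hs1 : SuppGE 1 (lz (1 : Fin (n + 3))) := suppGE_single (by simp) _
  have hs2 : SuppGE 1 (lz (2 : Fin (n + 3))) := suppGE_single (by omega) _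
  have hR : ∀ v : Label (n + 3), SuppGE 1 v → v ≠ 0 → R ω (lz 0 + v) ∈ lift G := fun v hv hv0 =>
    R_lz_add_mem hK htail (suppGE_single (by simp) _) (lx_ne_zero 1) hZX hv hv0
  have h12' : (lz 1 + lz 2 : Label (n + 3)) ≠ 0 := fun h0 => by
    have := congrFun h0 1
    rw [Pi.add_apply, lz_self, lz_of_ne h12, Pi.zero_apply] at this
    exact absurd this (by decide)
  -- In `R_lz_mul_three` every factor other than `R (lz 0)` is now available. The label `lz 1 + lz
  -- 2` needs a third qubit.
  rw [← R_lz_mem_lift, ← Subgroup.mul_mem_cancel_right _ (mul_mem (mul_mem (htail _ hs1)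
    (htail _ hs2)) (hR _ (hs1.add hs2) h12')), R_lz_mul_three h01 h02 h12]
  exact mul_mem (mul_mem (hR _ hs1 (lz_ne_zero 1)) (hR _ hs2 (lz_ne_zero 2)))
    (htail _ (hs1.add hs2))

theorem F_le {G : Subgroup (ProjClifford ω (n + 2))} (hM : M ω n ∈ G) (hY : sqrtY ω (n + 2) ∈ G)
    (htail : tailGates ω (n + 2) ⊆ G) : F ω (n + 2) ≤ G := by
  match n, G with
  | 0, G =>
    rw [F_two, Subgroup.closure_le]
    exact Set.union_subset (Set.insert_subset hM (Set.singleton_subset_iff.mpr hY)) htail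
  | n + 1, G =>
    rw [F, Subgroup.closure_le]
    exact Set.union_subset (Set.singleton_subset_iff.mpr hM) htail

theorem sqrtY_mem_F_two : sqrtY ω 2 ∈ F ω 2 := by
  rw [F_two]
  exact Subgroup.subset_closure (Or.inl (Or.inr rfl))

/-! ### Conjugating `F` onto the centralizer -/

theorem mem_comap_conj {G : Type*} [Group G] {H : Subgroup G} {c g : G} :
    g ∈ H.comap (MulAut.conj c).toMonoidHom ↔ c * g * c⁻¹ ∈ H := Iff.rfl

theorem conj_mem_map_conj {G : Type*} [Group G] {H : Subgroup G} {c g : G} :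
    c * g * c⁻¹ ∈ H.map (MulAut.conj c).toMonoidHom ↔ g ∈ H :=
  Subgroup.mem_map_iff_mem (f := (MulAut.conj c).toMonoidHom) (MulAut.conj c).injective

theorem map_conj_F_le : (F ω (n + 2)).map
    (MulAut.conj (h ω (0 : Fin (n + 2)) * s ω 0)).toMonoidHom ≤
      Subgroup.centralizer {s ω (0 : Fin (n + 2))} := by
  rw [Subgroup.map_le_iff_le_comap]
  refine F_le ?_ ?_ fun g hg => ?_
  · rw [mem_comap_conj]
    exact conj_M_mem_centralizer
  · rw [mem_comap_conj, conj_sqrtY]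
    exact s_mem_centralizer 0
  · rw [SetLike.mem_coe, mem_comap_conj, commute_h_mul_s_tailGates hg]
    exact tailGates_subset_centralizer hg

theorem le_map_conj_F : Subgroup.centralizer {s ω (0 : Fin (n + 2))} ≤ (F ω (n + 2)).map
    (MulAut.conj (h ω (0 : Fin (n + 2)) * s ω 0)).toMonoidHom := by
  have htail : tailGates ω (n + 2) ⊆ (F ω (n + 2)).map
      (MulAut.conj (h ω (0 : Fin (n + 2)) * s ω 0)).toMonoidHom := fun g hg => by
    rw [← commute_h_mul_s_tailGates hg, SetLike.mem_coe, conj_mem_map_conj]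
    exact tailGates_subset_F hg
  have hZX := (conj_M_mem_iff htail).mp (conj_mem_map_conj.mpr M_mem_F)
  refine centralizer_le_of_gates htail ?_ (suppGE_single (by simp) _) (lx_ne_zero 1) hZX
  -- On two qubits `sqrtY` is a generator of `F` and conjugates to the phase gate; from three qubits
  -- on, the phase gate is derived from the other generators.
  match n, htail, hZX with
  | 0, _, _ =>
    have h1 := (conj_mem_map_conj (c := h ω (0 : Fin 2) * s ω 0)).mpr sqrtY_mem_F_two
    rwa [conj_sqrtY] at h1
  | n + 1, htail, hZX => exact s_zero_mem htail hZX

/-- The centralizer of the first phase gate is conjugate to `F`. -/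
theorem centralizer_eq_map_F (ω : EighthRoot) (n : ℕ) [hn : NeZero n] :
    Subgroup.centralizer {s ω (0 : Fin n)} =
      (F ω n).map (MulAut.conj (h ω (0 : Fin n) * s ω 0)).toMonoidHom := by
  match n, hn with
  | 0, hn => exact absurd rfl hn.out
  | 1, _ =>
    rw [F, MonoidHom.map_closure, Set.image_singleton]
    refine centralizer_one.trans ?_
    congr 2
    exact conj_sqrtY.symm
  | n + 2, _ => exact le_antisymm le_map_conj_F map_conj_F_le

/-- The conjugation taking `F` to the centralizer of `s₁` takes `sqrtY` to `s₁`. -/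
theorem F_eq_centralizer (ω : EighthRoot) (n : ℕ) [NeZero n] :
    F ω n = Subgroup.centralizer {sqrtY ω n} := by
  set c := h ω (0 : Fin n) * s ω 0 with hc
  have h1 : c * sqrtY ω n * c⁻¹ = s ω 0 := conj_sqrtY
  have h2 := centralizer_eq_map_F ω n
  ext g
  have h3 : g ∈ F ω n ↔ c * g * c⁻¹ ∈ Subgroup.centralizer {s ω (0 : Fin n)} := by
    rw [h2, ← hc, conj_mem_map_conj]
  rw [h3, Subgroup.mem_centralizer_singleton_iff, Subgroup.mem_centralizer_singleton_iff, ← h1,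
    conj_mul, conj_mul, mul_left_inj, mul_right_inj]

/-! ### The inertia subgroup -/

theorem sqrtY_mem_F [NeZero n] : sqrtY ω n ∈ F ω n := by
  rw [F_eq_centralizer, Subgroup.mem_centralizer_singleton_iff]

/-- Only two qubits need an argument: there `h₁s₁²h₁ = h₁ * sqrtY`, so in the presence of `h₁` it is
interchangeable with `sqrtY`. -/
theorem IN_eq (ω : EighthRoot) (n : ℕ) [hn : NeZero n] :
    IN ω n = F ω n ⊔ Subgroup.closure {h ω (0 : Fin n)} := by
  match n, hn with
  | 0, hn => exact absurd rfl hn.out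
  | 1, _ =>
    rw [F, ← Subgroup.closure_union, Set.union_comm]
    rfl
  | 2, _ =>
    have hh : h ω (0 : Fin 2) ∈ IN ω 2 := Subgroup.subset_closure (Or.inl rfl)
    have hX : h ω 0 * s ω 0 ^ 2 * h ω 0 ∈ IN ω 2 :=
      Subgroup.subset_closure (Or.inr (Or.inr (Or.inr (Or.inl rfl))))
    have hF : F ω 2 ≤ F ω 2 ⊔ Subgroup.closure {h ω (0 : Fin 2)} := le_sup_left
    have hh' : h ω (0 : Fin 2) ∈ F ω 2 ⊔ Subgroup.closure {h ω (0 : Fin 2)} :=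
      (le_sup_right : _ ≤ F ω 2 ⊔ Subgroup.closure {h ω (0 : Fin 2)})
        (Subgroup.subset_closure (Set.mem_singleton _))
    apply le_antisymm
    · rw [IN, Subgroup.closure_le]
      rintro g (rfl | rfl | rfl | rfl | rfl)
      · exact hh'
      · exact hF (tailGates_subset_F ⟨1, by simp, Or.inl rfl⟩)
      · exact hF (tailGates_subset_F ⟨1, by simp, Or.inr (Or.inl rfl)⟩)
      · rw [mul_assoc, ← sqrtY_eq]
        exact mul_mem hh' (hF sqrtY_mem_F)
      · exact hF M_mem_F
    · rw [sup_le_iff, Subgroup.closure_le, Set.singleton_subset_iff]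
      refine ⟨?_, hh⟩
      rw [F_two, tailGates_two, Subgroup.closure_le]
      rintro g ((rfl | rfl) | (rfl | rfl))
      · exact Subgroup.subset_closure (Or.inr (Or.inr (Or.inr (Or.inr rfl))))
      · rw [sqrtY_eq, SetLike.mem_coe, ← Subgroup.mul_mem_cancel_left _ hh, ← mul_assoc]
        exact hX
      · exact Subgroup.subset_closure (Or.inr (Or.inl rfl))
      · exact Subgroup.subset_closure (Or.inr (Or.inr (Or.inl rfl)))
  | n + 3, _ =>
    rw [F, ← Subgroup.closure_union, Set.union_comm, ← Set.union_assoc, Set.singleton_union]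
    rfl

/-- If `t` is an involution inverting `f` and `f` is not an involution, then the centralizer of `f`
has index two in the group generated by it and `t`. -/
theorem centralizer_index_two {G : Type*} [Group G] {f t : G} (ht : t * t = 1)
    (htf : t * f * t⁻¹ = f⁻¹) (hf : f * f ≠ 1) {N : Subgroup G}
    (hN : N = Subgroup.centralizer {f} ⊔ Subgroup.closure {t}) :
    ((Subgroup.centralizer {f}).subgroupOf N).Normal ∧
      (Subgroup.centralizer {f}).relIndex N = 2 := by
  have ht' : t⁻¹ = t := inv_eq_of_mul_eq_one_left ht
  have htf' : t * f = f⁻¹ * t := mul_inv_eq_iff_eq_mul.mp htf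
  have htf2 : t * f⁻¹ = f * t := by
    rw [← mul_right_inj t, ← mul_assoc, ht, one_mul, ← mul_assoc, htf', mul_assoc, ht, mul_one]
  have hconj : ∀ g ∈ Subgroup.centralizer {f}, t * g * t ∈ Subgroup.centralizer {f} := by
    intro g hg
    have hg' : Commute g f⁻¹ := Commute.inv_right (Subgroup.mem_centralizer_singleton_iff.mp hg)
    rw [Subgroup.mem_centralizer_singleton_iff]
    calc t * g * t * f = t * (g * f⁻¹) * t := by rw [mul_assoc _ t f, htf']; simp only [mul_assoc]
      _ = t * f⁻¹ * g * t := by rw [hg'.eq]; simp only [mul_assoc]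
      _ = f * (t * g * t) := by rw [htf2]; simp only [mul_assoc]
  have htn : t ∉ Subgroup.centralizer {f} := by
    rw [Subgroup.mem_centralizer_singleton_iff, htf', mul_left_inj, inv_eq_iff_mul_eq_one]
    exact hf
  -- As `t` normalizes the centralizer of `f`, the group `N` is the union of that centralizer and
  -- its coset by `t`; these differ because `f ≠ f⁻¹`.
  have hmem : ∀ g ∈ N, g ∈ Subgroup.centralizer {f} ∨ g * t ∈ Subgroup.centralizer {f} := by
    intro g hg
    rw [hN, ← Subgroup.closure_eq (Subgroup.centralizer {f}), ← Subgroup.closure_union] at hg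
    induction hg using Subgroup.closure_induction_right with
    | one => exact Or.inl (one_mem _)
    | mul_right x _ y hy hx =>
      rcases hy with hy | rfl
      · rcases hx with hx | hx
        · exact Or.inl (mul_mem hx hy)
        · right
          have e : x * y * t = (x * t) * (t * y * t) := by
            simp only [← mul_assoc]; rw [mul_assoc x t t, ht, mul_one]
          rw [e]
          exact mul_mem hx (hconj y hy)
      · rcases hx with hx | hx
        · right
          rwa [mul_assoc, ht, mul_one]
        · exact Or.inl hx
    | mul_inv_cancel x _ y hy hx =>
      rcases hy with hy | rfl
      · rcases hx with hx | hx
        · exact Or.inl (mul_mem hx (inv_mem hy))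
        · right
          have e : x * y⁻¹ * t = (x * t) * (t * y⁻¹ * t) := by
            simp only [← mul_assoc]; rw [mul_assoc x t t, ht, mul_one]
          rw [e]
          exact mul_mem hx (hconj _ (inv_mem hy))
      · rw [ht']
        rcases hx with hx | hx
        · right
          rwa [mul_assoc, ht, mul_one]
        · exact Or.inl hx
  have htN : t ∈ N := by
    rw [hN]
    exact (le_sup_right : _ ≤ Subgroup.centralizer {f} ⊔ Subgroup.closure {t})
      (Subgroup.subset_closure (Set.mem_singleton _))
  have hidx : ((Subgroup.centralizer {f}).subgroupOf N).index = 2 := by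
    rw [Subgroup.index_eq_two_iff]
    refine ⟨⟨t, htN⟩, fun g => ?_⟩
    simp only [Subgroup.mem_subgroupOf, Subgroup.coe_mul]
    rcases hmem g g.2 with hg | hg
    · exact Or.inr ⟨hg, fun h0 => htn ((Subgroup.mul_mem_cancel_left _ hg).mp h0)⟩
    · exact Or.inl ⟨hg, fun h0 => htn ((Subgroup.mul_mem_cancel_left _ h0).mp hg)⟩
  exact ⟨Subgroup.normal_of_index_eq_two hidx, hidx⟩

/-! ### Finiteness -/

/-- Modulo phases a Clifford operator is determined by the signed labels of its images of the `X`
and `Z` generators, which leaves finitely many possibilities. -/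
instance finite_projClifford (ω : EighthRoot) (n : ℕ) : Finite (ProjClifford ω n) := by
  classical
  have hex : ∀ (A : Clifford ω n) (v : Label n), ∃ p : Label n × Bool,
      A.1 * W ω v * A.1⁻¹ = if p.2 then W ω p.1 else -W ω p.1 := by
    intro A v
    obtain ⟨w, hw | hw⟩ := exists_moves A.2 v
    · exact ⟨(w, true), by simpa using hw⟩
    · exact ⟨(w, false), by simpa using hw⟩
  choose φ hφ using hex
  choose rep hrep using toProj_surjective (ω := ω) (n := n)
  refine Finite.of_injective
    (fun g (i : Fin n) => (φ (rep g) (lx i), φ (rep g) (lz i))) fun g g' hgg => ?_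
  rw [← hrep g, ← hrep g', toProj_eq_iff]
  have key : ∀ v, φ (rep g) v = φ (rep g') v → Fixes ω ((rep g).1⁻¹ * (rep g').1) v := by
    intro v hv
    have h1 := (hφ (rep g) v).trans (hv ▸ (hφ (rep g') v).symm)
    calc (rep g).1⁻¹ * (rep g').1 * W ω v
        = (rep g).1⁻¹ * ((rep g').1 * W ω v * (rep g').1⁻¹) * (rep g').1 := by group
      _ = W ω v * ((rep g).1⁻¹ * (rep g').1) := by rw [← h1]; group
  refine mem_phases_of_fixesBelow (ω := ω) fun i _ => ?_
  have h1 := congrFun hgg i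
  exact ⟨key _ (congrArg Prod.fst h1), key _ (congrArg Prod.snd h1)⟩

end

end QubitClifford

/-! ### Assembly of the theorem -/

theorem mainTheorem3 (ω : QubitClifford.EighthRoot) (n : ℕ) [NeZero n] :
    -- the case of one qubit
    (n = 1 →
      Subgroup.centralizer {QubitClifford.s ω (0 : Fin n)} =
        Subgroup.closure {QubitClifford.s ω (0 : Fin n)}) ∧
    -- the case of at least two qubits, with and without the generator `s₁`
    (2 ≤ n →
      Subgroup.centralizer {QubitClifford.s ω (0 : Fin n)} =
        Subgroup.closure
          ({g | ∃ i : Fin n, i ≠ 0 ∧ g = QubitClifford.h ω i} ∪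
            {g | ∃ i : Fin n, g = QubitClifford.s ω i} ∪
            {g | ∃ (i : Fin n) (hi : (i : ℕ) + 1 < n), g = QubitClifford.lam ω i hi}) ∧
      Subgroup.centralizer {QubitClifford.s ω (0 : Fin n)} =
        Subgroup.closure
          ({g | ∃ i : Fin n, i ≠ 0 ∧ g = QubitClifford.h ω i} ∪
            {g | ∃ i : Fin n, i ≠ 0 ∧ g = QubitClifford.s ω i} ∪
            {g | ∃ (i : Fin n) (hi : (i : ℕ) + 1 < n), g = QubitClifford.lam ω i hi})) ∧
    -- the centralizer is `h₁ s₁ F s₁³ h₁`, and this is a conjugate of `F`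
    (Subgroup.centralizer {QubitClifford.s ω (0 : Fin n)} : Set (QubitClifford.ProjClifford ω n)) =
      {g | ∃ f ∈ QubitClifford.F ω n,
        g = QubitClifford.h ω 0 * QubitClifford.s ω 0 * f * QubitClifford.s ω 0 ^ 3 *
          QubitClifford.h ω 0} ∧
    (∃ c : QubitClifford.ProjClifford ω n,
      Subgroup.centralizer {QubitClifford.s ω (0 : Fin n)} =
        (QubitClifford.F ω n).map (MulAut.conj c).toMonoidHom) ∧
    -- `F` is a normal subgroup of index two of the finite group `IN`
    Finite (QubitClifford.IN ω n) ∧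
    QubitClifford.F ω n ≤ QubitClifford.IN ω n ∧
    ((QubitClifford.F ω n).subgroupOf (QubitClifford.IN ω n)).Normal ∧
    (QubitClifford.F ω n).relIndex (QubitClifford.IN ω n) = 2 ∧
    -- hence the order of the centralizer
    2 * Nat.card (Subgroup.centralizer {QubitClifford.s ω (0 : Fin n)}) =
      Nat.card (QubitClifford.IN ω n) := by
  open QubitClifford in
  have hmap := centralizer_eq_map_F ω n
  have hle : F ω n ≤ IN ω n := by
    rw [IN_eq]
    exact le_sup_left
  -- `sqrtY` is conjugate to the phase gate, whose square `Z` is not scalar.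
  have hff : sqrtY ω n * sqrtY ω n ≠ 1 := by
    intro h0
    refine s_mul_s_ne_one (ω := ω) (0 : Fin n) ?_
    rw [← conj_sqrtY, conj_mul, h0, mul_one, mul_inv_cancel]
  have hN := IN_eq ω n
  rw [F_eq_centralizer] at hN
  obtain ⟨hnormal, hindex⟩ := centralizer_index_two (h_mul_h 0) h_sqrtY_h hff hN
  rw [← F_eq_centralizer] at hnormal hindex
  refine ⟨?_, ?_, ?_, ⟨_, hmap⟩, inferInstance, hle, hnormal, hindex, ?_⟩
  · rintro rfl
    exact centralizer_one
  · intro hn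
    obtain ⟨m, rfl⟩ := Nat.exists_eq_add_of_le' hn
    have h1 : Subgroup.centralizer {s ω (0 : Fin (m + 2))} ≤
        Subgroup.closure (centGates ω (m + 2)) := centralizer_le_closure_centGates
    have h2 : Subgroup.closure (centGates ω (m + 2)) ≤ Subgroup.closure
          ({g | ∃ i : Fin (m + 2), i ≠ 0 ∧ g = QubitClifford.h ω i} ∪
            {g | ∃ i : Fin (m + 2), g = QubitClifford.s ω i} ∪
            {g | ∃ (i : Fin (m + 2)) (hi : (i : ℕ) + 1 < m + 2), g = lam ω i hi}) :=
      Subgroup.closure_mono (Set.union_subset_union_left _ (Set.union_subset_union_right _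
        fun g ⟨i, _, hg⟩ => ⟨i, hg⟩))
    have h3 : Subgroup.closure
          ({g | ∃ i : Fin (m + 2), i ≠ 0 ∧ g = QubitClifford.h ω i} ∪
            {g | ∃ i : Fin (m + 2), g = QubitClifford.s ω i} ∪
            {g | ∃ (i : Fin (m + 2)) (hi : (i : ℕ) + 1 < m + 2), g = lam ω i hi}) ≤
        Subgroup.centralizer {s ω (0 : Fin (m + 2))} := by
      rw [Subgroup.closure_le]
      rintro g ((⟨i, hi, rfl⟩ | ⟨i, rfl⟩) | ⟨i, hi, rfl⟩)
      · exact h_mem_centralizer hi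
      · exact s_mem_centralizer i
      · exact lam_mem_centralizer i hi
    exact ⟨le_antisymm (h1.trans h2) h3, le_antisymm h1 (h2.trans h3)⟩
  · rw [hmap]
    ext g
    simp only [Subgroup.coe_map, Set.mem_image, Set.mem_ofPred_eq, SetLike.mem_coe]
    refine exists_congr fun f => and_congr_right fun _ => ?_
    change h ω (0 : Fin n) * s ω 0 * f * (h ω (0 : Fin n) * s ω 0)⁻¹ = g ↔ _
    rw [h_mul_s_inv, ← mul_assoc, eq_comm]
  · have h1 : Nat.card (Subgroup.centralizer {s ω (0 : Fin n)}) = Nat.card (F ω n) := by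
      rw [hmap]
      exact (Nat.card_congr ((F ω n).equivMapOfInjective _ (MulAut.conj _).injective).toEquiv).symm
    rw [h1, ← Subgroup.card_mul_index ((F ω n).subgroupOf (IN ω n)),
      Nat.card_congr (Subgroup.subgroupOfEquivOfLe hle).toEquiv, mul_comm]
    congr 1
    exact hindex.symm
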